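/- Let $n\ge 3$ and consider $\pm1$-valued observables $A_i,B_i$ ($1\le i\le n$) and $N_{ij}=N_{ji}$ ($i\ne j$). A quantum realization consists of a complex Hilbert space $\mathcal H$ of arbitrary dimension, a unit vector $|\psi\rangle\in\mathcal H$, and bounded self-adjoint operators $A_i,B_i,N_{ij}$ on $\mathcal H$ whose squares are $\mathbb 1$; no commutation relation is assumed. For a sequence $M_1\to\dots\to M_r$ of such observables, $\langle M_1\cdots M_r\rangle_{\rm seq}$ is the expected product of the outcomes when they are measured projectively, one after the other, on $|\psi\rangle$: $$\langle M_1\cdots M_r\rangle_{\rm seq}=\sum_{m_1,\dots,m_r=\pm1}m_1\cdots m_r\,\Big\|\tfrac{\mathbb 1+m_rM_r}{2}\cdots\tfrac{\mathbb 1+m_1M_1}{2}|\psi\rangle\Big\|^2=\tfrac1{2^{r-1}}\langle\psi|\{M_1,\{M_2,\dots,\{M_{r-1},M_r\}\}\}|\psi\rangle .$$ For a finite set of measurements, $\langle M_1\cdots M_r\rangle_\pi$ is the average of $\langle M_{\sigma(1)}\cdots M_{\sigma(r)}\rangle_{\rm seq}$ over a set of orders $\sigma$, fixed once and for all for each correlator,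 such that each of the $r!$ products $M_{\tau(1)}\cdots M_{\tau(r)}$ occurs when the corresponding nested anticommutators are expanded; any such choice is allowed. Put $\alpha_n=\binom{n-1}{2}$ and $$T_n=(n-2)\sum_{\{i,j\}}\Big\langle A_iA_jN_{ij}\prod_{k\ne i,j}B_k\Big\rangle_\pi+\alpha_n\sum_i\Big\langle A_i\prod_{k\ne i}B_k\Big\rangle_\pi-\sum_{\{i,j,k\}}\Big\langle A_iA_jA_k\prod_{l\ne i,j,k}B_l\Big\rangle_\pi+\sum_{\{i,j,k\}}\big(\langle N_{ij}N_{jk}\rangle_\pi+\langle N_{jk}N_{ki}\rangle_\pi+\langle N_{ki}N_{ij}\rangle_\pi\big),$$ the sums running over 2-element subsets, elements and 3-element subsets of $\{1,\dots,n\}$. Let $|G_n\rangle=2^{-n/2}\sum_{x\in\{0,1\}^n}(-1)^{\#\{i<j:\,x_i=x_j=1\}}|x\rangle$. Then: 1. The maximum of $T_n$ over deterministic assignments of values $\pm1$ to the observables (each correlator being replaced by the product of the values) is $\eta_C=2n\alpha_n+2\binom n3$. Every quantum realization satisfies $T_n\le\eta_Q=2n\alpha_n+4\binom n3$, and $\eta_C<\eta_Q$.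 2. $|G_n\rangle$ is the complete-graph state: up to a phase it is the unique unit vector $\varphi\in(\mathbb C^2)^{\otimes n}$ with $X_i\prod_{k\ne i}Z_k\,\varphi=\varphi$ for all $i$. The state $|G_n\rangle$ with $A_i=X_i$, $B_j=Z_j$, $N_{ij}=X_i\otimes X_j\bigotimes_{k\ne i,j}Z_k$ is a quantum realization with $T_n=\eta_Q$. 3. Suppose that a quantum realization attains $T_n=\eta_Q$. Let $V_n$ be the span of the vectors $B_{i_1}\cdots B_{i_k}|\psi\rangle$ with $0\le k\le n$ and $i_1<\dots<i_k$, and let $P:\mathcal H\to V_n$ be the orthogonal projection, with adjoint $P^\dagger$ the inclusion. Then $|\psi\rangle\in V_n$, the subspace $V_n$ is invariant under all $A_i,B_j,N_{ij}$, $\dim V_n=2^n$ (so $\dim\mathcal H\ge2^n$), and there is a unitary $U:V_n\to(\mathbb C^2)^{\otimes n}=\mathbb C^{2^n}$ such that $$U(PA_iP^\dagger)U^\dagger=X_i,\quad U(PB_jP^\dagger)U^\dagger=Z_j,\quad U(PN_{ij}P^\dagger)U^\dagger=X_i\otimes X_j\bigotimes_{k\ne i,j}Z_k,\quad U(P|\psi\rangle)=|G_n\rangle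 .$$ -/

import Mathlib

noncomputable section

namespace TemporalSelfTest

/-! ### Sequential projective measurements of `±1`-valued observables -/

section Sequential

variable {H : Type*} [NormedAddCommGroup H] [InnerProductSpace ℂ H]

/-- For an observable `M` with `M² = 1`, the spectral projection `(1 + m M) / 2` of the
outcome `m = ±1`. -/
def outcomeProj (M : H →L[ℂ] H) (m : ℤˣ) : H →L[ℂ] H :=
  (1 / 2 : ℂ) • (1 + ((m : ℤ) : ℂ) • M)

/-- Born's rule with the projection postulate: the probability of the outcomes `m 0, m 1, …` when
the observables in the list `L` are measured one after the other, the head of `L` first, on the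
pure state `ψ`. -/
def jointProb (ψ : H) (L : List (H →L[ℂ] H)) (m : Fin L.length → ℤˣ) : ℝ :=
  ‖(List.ofFn fun t => outcomeProj (L.get t) (m t)).foldl (fun v Q => Q v) ψ‖ ^ 2

/-- The sequential correlation: the expected product of the outcomes. -/
def seqCorr (ψ : H) (L : List (H →L[ℂ] H)) : ℝ :=
  ∑ m : Fin L.length → ℤˣ, (∏ t, ((m t : ℤ) : ℝ)) * jointProb ψ L m

end Sequential

/-! ### Symmetrized sequential correlations -/

section Scheme

variable {α : Type*} [DecidableEq α]

/-- The words that occur when the nested anticommutator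
`{a₁, {a₂, …, {aₘ₋₁, aₘ}}}` of the letters of the list `[a₁, …, aₘ]` is multiplied out. -/
def expansion : List α → Finset (List α)
  | [] => {[]}
  | a :: l => (expansion l).image (fun w => a :: w) ∪ (expansion l).image (fun w => w ++ [a])

/-- `l` lists every element of `c` exactly once. -/
def IsOrdering (c : Finset α) (l : List α) : Prop :=
  l.Nodup ∧ l.toFinset = c

/-- A choice of sequential correlations for the measurements in `c`: a finite set of orders
in which they are measured, such that every permutation of them occurs in at least one of the
nested anticommutators that express these sequential correlations. -/
structure PermScheme (c : Finset α) where
  orders : Finset (List α)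
  isOrdering : ∀ l ∈ orders, IsOrdering c l
  covers : ∀ w, IsOrdering c w → ∃ l ∈ orders, w ∈ expansion l

theorem mem_expansion_self (l : List α) : l ∈ expansion l := by
  induction l with
  | nil => simp [expansion]
  | cons a l ih => simp [expansion, ih]

/-- Measuring in all possible orders is such a choice. -/
instance (c : Finset α) : Nonempty (PermScheme c) :=
  ⟨{ orders := c.toList.permutations.toFinset
     isOrdering := fun l hl => by
       have h : l.Perm c.toList := by simpa using hl
       exact ⟨h.nodup_iff.2 c.nodup_toList, by rw [List.toFinset_eq_of_perm _ _ h]; simp⟩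
     covers := fun w hw => ⟨w, by
       have : w.Perm c.toList := hw.2 ▸ (List.toFinset_toList hw.1).symm
       simpa using this, mem_expansion_self w⟩ }⟩

variable {H : Type*} [NormedAddCommGroup H] [InnerProductSpace ℂ H]

/-- The correlator `⟨⋯⟩_π`: the average of the sequential correlations chosen by the scheme. -/
def piCorr {c : Finset α} (S : PermScheme c) (ψ : H) (M : α → H →L[ℂ] H) : ℝ :=
  (∑ l ∈ S.orders, seqCorr ψ (l.map M)) / (S.orders.card : ℝ)

end Scheme

/-! ### The `n`-qubit expression -/

/-- Unordered pairs `{i, j}` with `i ≠ j`. -/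
abbrev Edge (n : ℕ) : Type := {e : Sym2 (Fin n) // ¬ e.IsDiag}

/-- The names of the observables `A_i`, `B_i` and `N_ij = N_ji`. -/
inductive Obs (n : ℕ) : Type
  | A (i : Fin n) : Obs n
  | B (i : Fin n) : Obs n
  | N (e : Edge n) : Obs n
  deriving DecidableEq

/-- The observables `A_i` for `i ∈ s` together with the `B_k` for `k ∉ s`. -/
def ctxAB {n : ℕ} (s : Finset (Fin n)) : Finset (Obs n) :=
  Finset.univ.image fun k => if k ∈ s then Obs.A k else Obs.B k

/-- The observables `A_i`, `A_j`, `N_ij` together with the `B_k` for `k ≠ i, j`,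
where `e = {i, j}`. -/
def ctxABN {n : ℕ} (e : Edge n) : Finset (Obs n) :=
  insert (Obs.N e) (ctxAB (Finset.univ.filter fun k => k ∈ e.1))

/-- For `t = {i, j, k}` and `j ∈ t`: the two observables `N_ij` and `N_jk`. -/
def ctxNN {n : ℕ} (t : Finset (Fin n)) (j : Fin n) : Finset (Obs n) :=
  (Finset.univ.filter fun e : Edge n => j ∈ e.1 ∧ ∀ k ∈ e.1, k ∈ t).image Obs.N

/-- `α_n`. -/
def alpha (n : ℕ) : ℝ := ((n - 1).choose 2 : ℝ)

/-- The linear expression, as a function of the values of its correlators. -/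
def expr (n : ℕ) (corr : Finset (Obs n) → ℝ) : ℝ :=
  ((n : ℝ) - 2) * ∑ e : Edge n, corr (ctxABN e)
    + alpha n * ∑ i : Fin n, corr (ctxAB {i})
    - ∑ t ∈ Finset.powersetCard 3 (Finset.univ : Finset (Fin n)), corr (ctxAB t)
    + ∑ t ∈ Finset.powersetCard 3 (Finset.univ : Finset (Fin n)), ∑ j ∈ t, corr (ctxNN t j)

/-- The classical bound. -/
def etaC (n : ℕ) : ℝ := 2 * alpha n * n + 2 * (n.choose 3 : ℝ)

/-- The quantum bound. -/
def etaQ (n : ℕ) : ℝ := 2 * alpha n * n + 4 * (n.choose 3 : ℝ)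

/-- The value of the expression in the deterministic assignment `m` of outcomes. -/
def classicalValue (n : ℕ) (m : Obs n → ℤˣ) : ℝ :=
  expr n fun c => ∏ a ∈ c, ((m a : ℤ) : ℝ)

/-- The quantum value `T_n` for the state `ψ` and the observables `M`. -/
def temporalValue {n : ℕ} (π : ∀ c : Finset (Obs n), PermScheme c)
    {H : Type*} [NormedAddCommGroup H] [InnerProductSpace ℂ H]
    (ψ : H) (M : Obs n → H →L[ℂ] H) : ℝ :=
  expr n fun c => piCorr (π c) ψ M

/-- A pure state and dichotomic observables; no compatibility is required. -/
structure IsRealization {n : ℕ} {H : Type*} [NormedAddCommGroup H] [InnerProductSpace ℂ H]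
    [CompleteSpace H] (ψ : H) (M : Obs n → H →L[ℂ] H) : Prop where
  norm_state : ‖ψ‖ = 1
  selfAdjoint : ∀ a, IsSelfAdjoint (M a)
  sq_eq_one : ∀ a, M a * M a = 1

/-! ### The reference experiment on `n` qubits -/

/-- `(ℂ²)^{⊗ n}`, with the computational basis labelled by bit strings. -/
abbrev Qubits (n : ℕ) : Type := EuclideanSpace ℂ (Fin n → Fin 2)

def pauliX : Matrix (Fin 2) (Fin 2) ℂ := !![0, 1; 1, 0]

def pauliZ : Matrix (Fin 2) (Fin 2) ℂ := !![1, 0; 0, -1]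

/-- The operator `K₁ ⊗ ⋯ ⊗ Kₙ`. -/
def tensorOp {n : ℕ} (K : Fin n → Matrix (Fin 2) (Fin 2) ℂ) : Qubits n →L[ℂ] Qubits n :=
  Matrix.toEuclideanCLM (n := Fin n → Fin 2) (𝕜 := ℂ)
    (Matrix.of fun x y => ∏ k, K k (x k) (y k))

/-- `A_i = X_i`, `B_i = Z_i`, `N_ij = X_i X_j ⨂_{k ≠ i,j} Z_k`. -/
def pauliObs {n : ℕ} : Obs n → Qubits n →L[ℂ] Qubits n
  | .A i => tensorOp fun k => if k = i then pauliX else 1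
  | .B i => tensorOp fun k => if k = i then pauliZ else 1
  | .N e => tensorOp fun k => if k ∈ e.1 then pauliX else pauliZ

/-- A unit vector stabilized by `X_i ⨂_{k ∈ N(i)} Z_k` for every vertex `i` of the graph `Γ`. -/
def IsGraphState {n : ℕ} (Γ : SimpleGraph (Fin n)) (φ : Qubits n) : Prop :=
  open scoped Classical in
  ‖φ‖ = 1 ∧ ∀ i, tensorOp (fun k => if k = i then pauliX else if Γ.Adj i k then pauliZ else 1) φ = φ

/-- The complete-graph state `2^{-n/2} ∑_x (-1)^{#{i < j : x_i = x_j = 1}} |x⟩`. -/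
def completeGraphState (n : ℕ) : Qubits n :=
  WithLp.toLp 2 fun x =>
    ((Real.sqrt 2 : ℂ)⁻¹) ^ n *
      ∏ i : Fin n, ∏ j ∈ Finset.Ioi i, if x i = 1 ∧ x j = 1 then (-1 : ℂ) else 1

/-! ### The invariant subspace -/

section Subspace

variable {n : ℕ} {H : Type*} [NormedAddCommGroup H] [InnerProductSpace ℂ H]

/-- `B_{i₁} ⋯ B_{iₖ} ψ` for `s = {i₁ < ⋯ < iₖ}`. -/
def wordB (ψ : H) (M : Obs n → H →L[ℂ] H) (s : Finset (Fin n)) : H :=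
  (((List.finRange n).filter (· ∈ s)).map fun i => M (.B i)).prod ψ

/-- The subspace `V_n` spanned by these vectors. -/
def invSubspace (ψ : H) (M : Obs n → H →L[ℂ] H) : Submodule ℂ H :=
  Submodule.span ℂ (Set.range (wordB ψ M))

instance (ψ : H) (M : Obs n → H →L[ℂ] H) : FiniteDimensional ℂ (invSubspace ψ M) :=
  FiniteDimensional.span_of_finite ℂ (Set.finite_range _)

end Subspace

end TemporalSelfTest

end

open TemporalSelfTest

/-! Every symmetrized correlator lies in [-1, 1], and `etaQ` is the sum of the absolute values of
the coefficients of the expression, so the quantum bound is the algebraic one. Classically it is out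
of reach: the three-A value of a triple is the product p q r of the three one-A values, and p + q +
r - p q r ≤ 2 where 4 would be needed (`prod_ctxAB_eq_prod`, `sum_sub_prod_le_two`). For Pauli
operators the same product carries an extra minus sign (`ctxFactor_mul_mul`), so the graph state
attains 4.

If `etaQ` is attained, every correlator is extremal (`values_of_expr_eq_etaQ`). A nested
anticommutator is an iterated mean of words in isometries, so the equality case of Cauchy-Schwarz
makes each word of its expansion act on ψ as ±1 (`word_apply_eq_of_re_inner_eq_one`). By the
covering condition this holds for the letters of a context in every order, which replaces
commutation.

These word relations determine the rest. The N-N words and a comparison of three-A words with A-A-N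
words show that B_k A_k ψ does not depend on k (`IsExtremal.B_A_eq`), hence that the order of
distinct B's acting on ψ is irrelevant (`IsExtremal.bWord_perm`). Then each observable sends each
vector B_s ψ to ± some B_t ψ, with sign and t given by a table that depends only on the observable
and s (`IsExtremal.apply_wordB`). The table also gives orthonormality of these vectors
(`IsExtremal.orthonormal_wordB`). The reference experiment is extremal too and obeys the same table,
so the unitary matching the two bases intertwines all observables (`IsExtremal.exists_unitary`). -/

namespace TemporalSelfTest

/-! ### Sequential correlations as nested anticommutators, and their equality case -/

section Sequential

variable {H : Type*} [NormedAddCommGroup H] [InnerProductSpace ℂ H]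

/-- The nested anticommutator `{M₁, {M₂, …, {Mᵣ₋₁, Mᵣ}}} / 2 ^ (r - 1)`. -/
noncomputable def nestedAnticomm : List (H →L[ℂ] H) → (H →L[ℂ] H)
  | [] => 1
  | M :: L => (1 / 2 : ℂ) • (M * nestedAnticomm L + nestedAnticomm L * M)

theorem seqCorr_nil (ψ : H) : seqCorr ψ [] = ‖ψ‖ ^ 2 := by
  simp [seqCorr, jointProb]

/-- Conditioning on the first outcome leaves the unnormalized projected vector as the state for the
remaining measurements; this is why `seqCorr` is handled for vectors of any norm. -/
theorem seqCorr_cons (ψ : H) (M : H →L[ℂ] H) (L : List (H →L[ℂ] H)) :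
    seqCorr ψ (M :: L) = ∑ m : ℤˣ, ((m : ℤ) : ℝ) * seqCorr (outcomeProj M m ψ) L := by
  unfold seqCorr
  simp only [Finset.mul_sum]
  rw [← Fintype.sum_prod_type']
  refine (Fintype.sum_equiv (Fin.consEquiv (fun _ : Fin (L.length + 1) => ℤˣ)) _ _ ?_).symm
  rintro ⟨m, f⟩
  simp only [Fin.consEquiv_apply, List.length_cons]
  rw [Fin.prod_univ_succ]
  simp only [Fin.cons_zero, Fin.cons_succ, jointProb, List.length_cons, List.ofFn_succ,
    List.foldl_cons, List.get_eq_getElem, Fin.val_zero, List.getElem_cons_zero, Fin.val_succ,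
    List.getElem_cons_succ, mul_assoc]
  rfl

theorem sum_intUnits (f : ℤˣ → ℝ) : ∑ m : ℤˣ, f m = f 1 + f (-1) := by
  rw [show (Finset.univ : Finset ℤˣ) = {1, -1} from rfl]
  rw [Finset.sum_pair (by decide)]

/-- The sequential correlation is the expectation value of the nested anticommutator. -/
theorem seqCorr_eq [CompleteSpace H] (L : List (H →L[ℂ] H)) (hL : ∀ M ∈ L, IsSelfAdjoint M) (ψ : H) :
    seqCorr ψ L = (inner ℂ ψ (nestedAnticomm L ψ)).re := by
  induction L generalizing ψ with
  | nil =>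
    simp [seqCorr_nil, nestedAnticomm, inner_self_eq_norm_sq_to_K, ← Complex.ofReal_pow]
  | cons M L ih =>
    have hM : ∀ x y, inner ℂ (M x) y = inner ℂ x (M y) := fun x y => by
      rw [← ContinuousLinearMap.adjoint_inner_right, (hL M (by simp)).adjoint_eq]
    rw [seqCorr_cons, sum_intUnits, ih (fun M hM => hL M (by simp [hM])),
      ih (fun M hM => hL M (by simp [hM]))]
    -- With P_m = (1 + mM)/2, the identity used is P_+ X P_+ - P_- X P_- = (MX + XM)/2.
    simp [outcomeProj, nestedAnticomm, inner_add_left, inner_smul_left,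
      inner_smul_right, hM, inner_neg_left, inner_neg_right]
    ring

section Words

variable {α : Type*} {M : α → H →L[ℂ] H}

theorem norm_nestedAnticomm_apply_le (hM : ∀ a v, ‖M a v‖ = ‖v‖) (l : List α) (v : H) :
    ‖nestedAnticomm (l.map M) v‖ ≤ ‖v‖ := by
  induction l generalizing v with
  | nil => simp [nestedAnticomm]
  | cons a l ih =>
    simp only [List.map_cons, nestedAnticomm, smul_apply,
      add_apply, mul_apply_eq_comp, norm_smul]
    have h1 := norm_add_le (M a (nestedAnticomm (l.map M) v)) (nestedAnticomm (l.map M) (M a v))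
    rw [hM] at h1
    have h2 := ih v
    have h3 := ih (M a v)
    rw [hM] at h3
    norm_num
    linarith

theorem abs_re_inner_nestedAnticomm_le (hM : ∀ a v, ‖M a v‖ = ‖v‖) (l : List α) {φ ψ : H}
    (hφ : ‖φ‖ = 1) (hψ : ‖ψ‖ = 1) :
    |(inner ℂ φ (nestedAnticomm (l.map M) ψ)).re| ≤ 1 := by
  refine (Complex.abs_re_le_norm _).trans ((norm_inner_le_norm _ _).trans ?_)
  rw [hφ, one_mul, ← hψ]
  exact norm_nestedAnticomm_apply_le hM l ψ

/-- Peeling off one letter moves it onto either the bra or the ket. The two vectors become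
different, so the induction must treat matrix elements and not just expectation values. -/
theorem re_inner_nestedAnticomm_cons (hs : ∀ a x y, inner ℂ (M a x) y = inner ℂ x (M a y))
    (a : α) (l : List α) (φ ψ : H) :
    (inner ℂ φ (nestedAnticomm ((a :: l).map M) ψ)).re =
      ((inner ℂ (M a φ) (nestedAnticomm (l.map M) ψ)).re +
        (inner ℂ φ (nestedAnticomm (l.map M) (M a ψ))).re) / 2 := by
  simp only [List.map_cons, nestedAnticomm, smul_apply,
    add_apply, mul_apply_eq_comp, inner_smul_right,
    inner_add_right, hs]
  simp
  ring

variable [DecidableEq α]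

/-- If the normalized nested anticommutator has the extremal matrix element `1` between unit
vectors, then so does each word of its expansion. -/
theorem word_apply_eq_of_re_inner_eq_one (hs : ∀ a x y, inner ℂ (M a x) y = inner ℂ x (M a y))
    (hsq : ∀ a v, M a (M a v) = v) (hM : ∀ a v, ‖M a v‖ = ‖v‖) (l : List α) {φ ψ : H}
    (hφ : ‖φ‖ = 1) (hψ : ‖ψ‖ = 1)
    (h : (inner ℂ φ (nestedAnticomm (l.map M) ψ)).re = 1) {w : List α} (hw : w ∈ expansion l) :
    (w.map M).prod ψ = φ := by
  induction l generalizing φ ψ w with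
  | nil =>
    simp only [expansion, Finset.mem_singleton] at hw
    subst hw
    have h' : RCLike.re (inner ℂ φ ψ) = 1 := by simpa [nestedAnticomm] using h
    -- Equality in Cauchy-Schwarz: unit vectors whose inner product has real part 1 coincide.
    have := norm_sub_sq (𝕜 := ℂ) φ ψ
    rw [hφ, hψ, h'] at this
    have h0 : ‖φ - ψ‖ = 0 := by nlinarith
    simpa using (sub_eq_zero.1 (norm_eq_zero.1 h0)).symm
  | cons a l ih =>
    have hφ' : ‖M a φ‖ = 1 := by rw [hM, hφ]
    have hψ' : ‖M a ψ‖ = 1 := by rw [hM, hψ]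
    rw [re_inner_nestedAnticomm_cons hs] at h
    -- A mean of two numbers that are at most 1 equals 1 only if both do.
    have h1 := (abs_le.1 (abs_re_inner_nestedAnticomm_le hM l hφ' hψ)).2
    have h2 := (abs_le.1 (abs_re_inner_nestedAnticomm_le hM l hφ hψ')).2
    simp only [expansion, Finset.mem_union, Finset.mem_image] at hw
    rcases hw with ⟨w, hw, rfl⟩ | ⟨w, hw, rfl⟩
    · simp [ih hφ' hψ (by linarith) hw, hsq]
    · simp [ih hφ hψ' (by linarith) hw]

/-- Converse direction, needed to evaluate the reference experiment. -/
theorem nestedAnticomm_apply_of_words (hsq : ∀ a v, M a (M a v) = v) (l : List α) {φ ψ : H}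
    (h : ∀ w ∈ expansion l, (w.map M).prod ψ = φ) : nestedAnticomm (l.map M) ψ = φ := by
  induction l generalizing φ ψ with
  | nil => simpa [nestedAnticomm, expansion] using h
  | cons a l ih =>
    have h1 : nestedAnticomm (l.map M) ψ = M a φ := ih fun w hw => by
      rw [← h (a :: w) (by simp [expansion, hw])]
      simp [hsq]
    have h2 : nestedAnticomm (l.map M) (M a ψ) = φ := ih fun w hw => by
      rw [← h (w ++ [a]) (by simp [expansion, hw])]
      simp
    simp only [List.map_cons, nestedAnticomm, smul_apply,
      add_apply, mul_apply_eq_comp, h1, h2, hsq]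
    rw [← two_smul ℂ, smul_smul]
    norm_num

theorem perm_of_mem_expansion {l w : List α} (hw : w ∈ expansion l) : w.Perm l := by
  induction l generalizing w with
  | nil => simp_all [expansion]
  | cons a l ih =>
    simp only [expansion, Finset.mem_union, Finset.mem_image] at hw
    rcases hw with ⟨w, hw, rfl⟩ | ⟨w, hw, rfl⟩
    · exact (ih hw).cons a
    · exact (List.perm_append_singleton a w).trans ((ih hw).cons a)

theorem IsOrdering.of_mem_expansion {c : Finset α} {l w : List α} (hl : IsOrdering c l)
    (hw : w ∈ expansion l) : IsOrdering c w := by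
  have h := perm_of_mem_expansion hw
  exact ⟨h.nodup_iff.2 hl.1, by rw [List.toFinset_eq_of_perm _ _ h, hl.2]⟩

theorem isOrdering_toList (c : Finset α) : IsOrdering c c.toList :=
  ⟨c.nodup_toList, by simp⟩

theorem PermScheme.card_pos {c : Finset α} (S : PermScheme c) : 0 < S.orders.card := by
  obtain ⟨l, hl, -⟩ := S.covers _ (isOrdering_toList c)
  exact Finset.card_pos.2 ⟨l, hl⟩

end Words

end Sequential

/-! ### Symmetrized correlators of a realization -/

section Realization

variable {n : ℕ} {H : Type*} [NormedAddCommGroup H] [InnerProductSpace ℂ H] [CompleteSpace H]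
  {ψ : H} {M : Obs n → H →L[ℂ] H}

theorem IsRealization.apply_apply (h : IsRealization ψ M) (a : Obs n) (v : H) :
    M a (M a v) = v := by
  rw [← mul_apply_eq_comp, h.sq_eq_one, one_apply_eq_self]

theorem IsRealization.inner_apply (h : IsRealization ψ M) (a : Obs n) (x y : H) :
    inner ℂ (M a x) y = inner ℂ x (M a y) := by
  rw [← ContinuousLinearMap.adjoint_inner_right, (h.selfAdjoint a).adjoint_eq]

theorem IsRealization.norm_apply (h : IsRealization ψ M) (a : Obs n) (v : H) :
    ‖M a v‖ = ‖v‖ := by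
  rw [← sq_eq_sq₀ (norm_nonneg _) (norm_nonneg _), ← @inner_self_eq_norm_sq ℂ,
    ← @inner_self_eq_norm_sq ℂ, h.inner_apply, h.apply_apply]

theorem IsRealization.injective (h : IsRealization ψ M) (a : Obs n) :
    Function.Injective (M a) :=
  Function.LeftInverse.injective (h.apply_apply a)

theorem IsRealization.seqCorr_map (h : IsRealization ψ M) (l : List (Obs n)) :
    seqCorr ψ (l.map M) = (inner ℂ ψ (nestedAnticomm (l.map M) ψ)).re :=
  seqCorr_eq _ (by simpa using fun a _ => h.selfAdjoint a) ψ

theorem IsRealization.abs_seqCorr_le (h : IsRealization ψ M) (l : List (Obs n)) :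
    |seqCorr ψ (l.map M)| ≤ 1 := by
  rw [h.seqCorr_map]
  exact abs_re_inner_nestedAnticomm_le h.norm_apply l h.norm_state h.norm_state

variable {c : Finset (Obs n)} (S : PermScheme c)

theorem IsRealization.abs_piCorr_le (h : IsRealization ψ M) : |piCorr S ψ M| ≤ 1 := by
  have hc : (0 : ℝ) < S.orders.card := by exact_mod_cast S.card_pos
  rw [piCorr, abs_div, abs_of_pos hc, div_le_one hc]
  refine (Finset.abs_sum_le_sum_abs _ _).trans ?_
  simpa using Finset.sum_le_card_nsmul _ _ 1 fun l _ => h.abs_seqCorr_le l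

/-- An extremal value of a symmetrized correlator fixes the action of all the words on `ψ`. -/
theorem IsRealization.word_apply_of_piCorr_eq (h : IsRealization ψ M) (ε : ℤˣ)
    (hS : piCorr S ψ M = ((ε : ℤ) : ℝ)) {w : List (Obs n)} (hw : IsOrdering c w) :
    (w.map M).prod ψ = ((ε : ℤ) : ℂ) • ψ := by
  have hc : (0 : ℝ) < S.orders.card := by exact_mod_cast S.card_pos
  have hε : ((ε : ℤ) : ℝ) * ((ε : ℤ) : ℝ) = 1 := by
    rcases Int.units_eq_one_or ε with rfl | rfl <;> simp
  obtain ⟨l, hl, hwl⟩ := S.covers w hw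
  have hle : ∀ l ∈ S.orders, ((ε : ℤ) : ℝ) * seqCorr ψ (l.map M) ≤ 1 := fun l _ => by
    have := abs_le.1 (h.abs_seqCorr_le l)
    rcases Int.units_eq_one_or ε with rfl | rfl <;> simp <;> linarith
  have hsum : ∑ l ∈ S.orders, ((ε : ℤ) : ℝ) * seqCorr ψ (l.map M) = ∑ l ∈ S.orders, 1 := by
    rw [piCorr, div_eq_iff hc.ne'] at hS
    rw [← Finset.mul_sum, hS, ← mul_assoc, hε]
    simp
  -- An average of terms bounded by 1 that equals 1 has all its terms equal to 1.
  have h1 := (Finset.sum_eq_sum_iff_of_le hle).1 hsum l hl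
  -- Taking φ = ε • ψ reduces the value -1 to the extremal value 1.
  refine word_apply_eq_of_re_inner_eq_one h.inner_apply h.apply_apply h.norm_apply l ?_
    h.norm_state ?_ hwl
  · rcases Int.units_eq_one_or ε with rfl | rfl <;> simp [h.norm_state]
  · rw [h.seqCorr_map] at h1
    rw [inner_smul_left]
    simpa using h1

theorem IsRealization.piCorr_eq_of_words (h : IsRealization ψ M) (ε : ℤˣ)
    (hw : ∀ w, IsOrdering c w → (w.map M).prod ψ = ((ε : ℤ) : ℂ) • ψ) :
    piCorr S ψ M = ((ε : ℤ) : ℝ) := by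
  have hc : (0 : ℝ) < S.orders.card := by exact_mod_cast S.card_pos
  rw [piCorr, div_eq_iff hc.ne', Finset.sum_congr rfl (g := fun _ => ((ε : ℤ) : ℝ))]
  · simp [mul_comm]
  · intro l hl
    rw [h.seqCorr_map, nestedAnticomm_apply_of_words h.apply_apply l
      fun w hwl => hw w ((S.isOrdering l hl).of_mem_expansion hwl), inner_smul_right,
      inner_self_eq_norm_sq_to_K, h.norm_state]
    simp

end Realization

/-! ### Weights, bounds and the classical maximum -/

section Counting

theorem card_edge (n : ℕ) : Fintype.card (Edge n) = n.choose 2 := by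
  rw [Sym2.card_subtype_not_diag, Fintype.card_fin]

/-- Both sides count triples with a marked element. -/
theorem alpha_mul (n : ℕ) : alpha n * n = 3 * (n.choose 3 : ℝ) := by
  rcases n with _ | n
  · simp
  · have := Nat.add_one_mul_choose_eq n 2
    rw [alpha]
    simp only [Nat.add_sub_cancel]
    norm_cast
    linarith

theorem sub_two_mul_choose_two (n : ℕ) :
    ((n : ℝ) - 2) * (n.choose 2 : ℝ) = 3 * (n.choose 3 : ℝ) := by
  rcases Nat.lt_or_ge n 2 with h | h
  · interval_cases n <;> simp [Nat.choose]
  · have := Nat.choose_succ_right_eq n 2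
    rw [← Nat.cast_ofNat, ← Nat.cast_sub h]
    norm_cast
    linarith

/-- Each index lies in `alpha n` triples. This spreads the one-A correlators over the triples, where
they meet the three-A correlators. -/
theorem sum_powersetCard_three_sum {n : ℕ} (p : Fin n → ℝ) :
    ∑ t ∈ Finset.powersetCard 3 (Finset.univ : Finset (Fin n)), ∑ i ∈ t, p i =
      alpha n * ∑ i, p i := by
  rw [Finset.sum_comm' (t' := Finset.univ)
    (s' := fun i => (Finset.powersetCard 3 Finset.univ).filter ({i} ⊆ ·)) (by simp), Finset.mul_sum]
  refine Finset.sum_congr rfl fun i _ => ?_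
  rw [Finset.sum_const, Finset.card_filter_powersetCard_subset _ _ _ (by simp) (by simp)]
  simp [alpha]

theorem sum_powersetCard_const (n : ℕ) (x : ℝ) :
    ∑ _t ∈ Finset.powersetCard 3 (Finset.univ : Finset (Fin n)), x = n.choose 3 * x := by
  simp

/-- The linear expression at the extremal values of its correlators. -/
theorem expr_of_values {n : ℕ} {corr : Finset (Obs n) → ℝ} {x : ℝ}
    (h1 : ∀ e, corr (ctxABN e) = 1) (h2 : ∀ i, corr (ctxAB {i}) = 1)
    (h3 : ∀ t : Finset (Fin n), t.card = 3 → corr (ctxAB t) = x)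
    (h4 : ∀ t : Finset (Fin n), t.card = 3 → ∀ j ∈ t, corr (ctxNN t j) = 1) :
    expr n corr = 2 * alpha n * n + (3 - x) * (n.choose 3 : ℝ) := by
  have e3 : ∑ t ∈ Finset.powersetCard 3 (Finset.univ : Finset (Fin n)), corr (ctxAB t) =
      n.choose 3 * x := by
    rw [← sum_powersetCard_const]
    exact Finset.sum_congr rfl fun t ht => h3 t (Finset.mem_powersetCard.1 ht).2
  have e4 : ∑ t ∈ Finset.powersetCard 3 (Finset.univ : Finset (Fin n)),
      ∑ j ∈ t, corr (ctxNN t j) = n.choose 3 * 3 := by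
    rw [← sum_powersetCard_const]
    refine Finset.sum_congr rfl fun t ht => ?_
    have ht := (Finset.mem_powersetCard.1 ht).2
    rw [Finset.sum_congr rfl (h4 t ht)]
    simp [ht]
  rw [expr, e3, e4]
  simp only [h1, h2, Finset.sum_const, Finset.card_univ, card_edge, Fintype.card_fin,
    nsmul_eq_mul, mul_one]
  rw [sub_two_mul_choose_two, ← alpha_mul]
  ring

/-- Ten is 3 + 3 + 1 + 3, the total weights of the four families of correlators in units of
`n.choose 3`. -/
theorem etaQ_eq (n : ℕ) : etaQ n = 10 * (n.choose 3 : ℝ) := by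
  have := alpha_mul n
  rw [etaQ]
  linarith

theorem etaC_eq (n : ℕ) : etaC n = 8 * (n.choose 3 : ℝ) := by
  have := alpha_mul n
  rw [etaC]
  linarith

theorem etaC_lt_etaQ {n : ℕ} (hn : 3 ≤ n) : etaC n < etaQ n := by
  have : (0 : ℝ) < n.choose 3 := by exact_mod_cast Nat.choose_pos hn
  rw [etaC_eq, etaQ_eq]
  linarith

/-- The gap to the algebraic bound, as a combination of nonnegative terms. -/
theorem etaQ_sub_expr (n : ℕ) (corr : Finset (Obs n) → ℝ) :
    etaQ n - expr n corr = ((n : ℝ) - 2) * ∑ e : Edge n, (1 - corr (ctxABN e))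
    + alpha n * ∑ i : Fin n, (1 - corr (ctxAB {i}))
    + ∑ t ∈ Finset.powersetCard 3 (Finset.univ : Finset (Fin n)), (1 + corr (ctxAB t))
    + ∑ t ∈ Finset.powersetCard 3 (Finset.univ : Finset (Fin n)),
        ∑ j ∈ t, (1 - corr (ctxNN t j)) := by
  have e4 : ∑ t ∈ Finset.powersetCard 3 (Finset.univ : Finset (Fin n)),
      ∑ j ∈ t, (1 - corr (ctxNN t j)) = n.choose 3 * 3 -
        ∑ t ∈ Finset.powersetCard 3 (Finset.univ : Finset (Fin n)), ∑ j ∈ t, corr (ctxNN t j) := by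
    rw [← sum_powersetCard_const, ← Finset.sum_sub_distrib]
    refine Finset.sum_congr rfl fun t ht => ?_
    simp [Finset.sum_sub_distrib, (Finset.mem_powersetCard.1 ht).2]
  rw [e4, Finset.sum_sub_distrib, Finset.sum_sub_distrib, Finset.sum_add_distrib,
    sum_powersetCard_const]
  simp only [Finset.sum_const, Finset.card_univ, card_edge, Fintype.card_fin,
    nsmul_eq_mul, mul_one, expr, etaQ_eq]
  have h1 := alpha_mul n
  have h2 := sub_two_mul_choose_two n
  linear_combination (-1 : ℝ) * h1 - h2

theorem alpha_pos {n : ℕ} (hn : 3 ≤ n) : 0 < alpha n := by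
  rw [alpha]
  exact_mod_cast Nat.choose_pos (by omega)

section Gap

variable {n : ℕ} {corr : Finset (Obs n) → ℝ}

theorem expr_le_etaQ (hn : 3 ≤ n) (h : ∀ c, |corr c| ≤ 1) : expr n corr ≤ etaQ n := by
  have h' := fun c => abs_le.1 (h c)
  have hn' : (3 : ℝ) ≤ n := by exact_mod_cast hn
  rw [← sub_nonneg, etaQ_sub_expr]
  have := (alpha_pos hn).le
  refine add_nonneg (add_nonneg (add_nonneg (mul_nonneg (by linarith) ?_) (mul_nonneg this ?_)) ?_)
    ?_
  · exact Finset.sum_nonneg fun e _ => by linarith [(h' (ctxABN e)).2]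
  · exact Finset.sum_nonneg fun i _ => by linarith [(h' (ctxAB {i})).2]
  · exact Finset.sum_nonneg fun t _ => by linarith [(h' (ctxAB t)).1]
  · exact Finset.sum_nonneg fun t _ => Finset.sum_nonneg fun j _ => by
      linarith [(h' (ctxNN t j)).2]

/-- The gap `etaQ_sub_expr` is a sum of nonnegative terms whose weights are strictly positive
because n ≥ 3, so a vanishing gap kills every term. -/
theorem values_of_expr_eq_etaQ (hn : 3 ≤ n) (h : ∀ c, |corr c| ≤ 1) (he : expr n corr = etaQ n) :
    (∀ e, corr (ctxABN e) = 1) ∧ (∀ i, corr (ctxAB {i}) = 1) ∧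
    (∀ t : Finset (Fin n), t.card = 3 → corr (ctxAB t) = -1) ∧
    (∀ t : Finset (Fin n), t.card = 3 → ∀ j ∈ t, corr (ctxNN t j) = 1) := by
  have h' := fun c => abs_le.1 (h c)
  have hn' : (3 : ℝ) ≤ n := by exact_mod_cast hn
  have ha := alpha_pos hn
  have gap := etaQ_sub_expr n corr
  rw [he, sub_self] at gap
  have n1 : ∀ e ∈ (Finset.univ : Finset (Edge n)), 0 ≤ 1 - corr (ctxABN e) :=
    fun e _ => by linarith [(h' (ctxABN e)).2]
  have n2 : ∀ i ∈ (Finset.univ : Finset (Fin n)), 0 ≤ 1 - corr (ctxAB {i}) :=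
    fun i _ => by linarith [(h' (ctxAB {i})).2]
  have n3 : ∀ t ∈ Finset.powersetCard 3 (Finset.univ : Finset (Fin n)), 0 ≤ 1 + corr (ctxAB t) :=
    fun t _ => by linarith [(h' (ctxAB t)).1]
  have n4' : ∀ t : Finset (Fin n), ∀ j ∈ t, 0 ≤ 1 - corr (ctxNN t j) :=
    fun t j _ => by linarith [(h' (ctxNN t j)).2]
  have n4 : ∀ t ∈ Finset.powersetCard 3 (Finset.univ : Finset (Fin n)),
      0 ≤ ∑ j ∈ t, (1 - corr (ctxNN t j)) := fun t _ => Finset.sum_nonneg (n4' t)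
  have s1 := mul_nonneg (show (0 : ℝ) ≤ n - 2 by linarith) (Finset.sum_nonneg n1)
  have s2 := mul_nonneg ha.le (Finset.sum_nonneg n2)
  have s3 := Finset.sum_nonneg n3
  have s4 := Finset.sum_nonneg n4
  have z1 := (mul_eq_zero.1 (le_antisymm (by linarith) s1)).resolve_left (by linarith)
  have z2 := (mul_eq_zero.1 (le_antisymm (by linarith) s2)).resolve_left ha.ne'
  have z3 := le_antisymm (by linarith) s3
  have z4 := le_antisymm (by linarith) s4
  rw [Finset.sum_eq_zero_iff_of_nonneg n1] at z1
  rw [Finset.sum_eq_zero_iff_of_nonneg n2] at z2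
  rw [Finset.sum_eq_zero_iff_of_nonneg n3] at z3
  rw [Finset.sum_eq_zero_iff_of_nonneg n4] at z4
  refine ⟨fun e => ?_, fun i => ?_, fun t ht => ?_, fun t ht j hj => ?_⟩
  · linarith [z1 e (Finset.mem_univ e)]
  · linarith [z2 i (Finset.mem_univ i)]
  · linarith [z3 t (by simp [ht])]
  · linarith [(Finset.sum_eq_zero_iff_of_nonneg (n4' t)).1 (z4 t (by simp [ht])) j hj]

end Gap

theorem prod_ctxAB {n : ℕ} (s : Finset (Fin n)) (f : Obs n → ℝ) :
    ∏ a ∈ ctxAB s, f a = ∏ k, f (if k ∈ s then Obs.A k else Obs.B k) := by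
  rw [ctxAB, Finset.prod_image]
  intro i _ j _ hij
  dsimp only at hij
  split_ifs at hij <;> simpa using hij

theorem abs_prod_units {ι : Type*} (c : Finset ι) (m : ι → ℤˣ) :
    |∏ a ∈ c, ((m a : ℤ) : ℝ)| ≤ 1 := by
  rw [Finset.abs_prod]
  refine Finset.prod_le_one (fun _ _ => abs_nonneg _) fun a _ => ?_
  rcases Int.units_eq_one_or (m a) with h | h <;> simp [h]

/-- For deterministic assignments, the three-`A` correlators are determined by the one-`A`
correlators. -/
theorem prod_ctxAB_eq_prod {n : ℕ} (m : Obs n → ℤˣ) {t : Finset (Fin n)} (ht : t.card = 3) :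
    ∏ a ∈ ctxAB t, ((m a : ℤ) : ℝ) = ∏ i ∈ t, ∏ a ∈ ctxAB {i}, ((m a : ℤ) : ℝ) := by
  obtain ⟨i, j, k, hij, hik, hjk, rfl⟩ := Finset.card_eq_three.1 ht
  rw [Finset.prod_insert (by simp [hij, hik]), Finset.prod_insert (by simp [hjk]),
    Finset.prod_singleton]
  simp only [prod_ctxAB, ← Finset.prod_mul_distrib]
  refine Finset.prod_congr rfl fun l _ => ?_
  -- Sitewise, the product of the three one-A words is A B² on the triple and B³ off it.
  have hb : ((m (Obs.B l) : ℤ) : ℝ) * ((m (Obs.B l) : ℤ) : ℝ) = 1 := by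
    rcases Int.units_eq_one_or (m (Obs.B l)) with h | h <;> simp [h]
  simp only [Finset.mem_insert, Finset.mem_singleton]
  by_cases h1 : l = i
  · subst h1; simp [hij, hik, hb]
  by_cases h2 : l = j
  · subst h2
    simp only [h1, hjk, true_or, or_true, if_true, if_false]
    linear_combination -((m (Obs.A l) : ℤ) : ℝ) * hb
  by_cases h3 : l = k
  · subst h3
    simp only [h1, h2, or_true, if_true, if_false]
    linear_combination -((m (Obs.A l) : ℤ) : ℝ) * hb
  · simp [h1, h2, h3, hb]

/-- A Mermin-type inequality: three signs equal to 1 cannot have product -1. It costs 2 per triple,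
exactly the gap between `etaC` and `etaQ`. -/
theorem sum_sub_prod_le_two {n : ℕ} (p : Fin n → ℝ) (hp : ∀ i, p i = 1 ∨ p i = -1)
    {t : Finset (Fin n)} (ht : t.card = 3) : ∑ i ∈ t, p i - ∏ i ∈ t, p i ≤ 2 := by
  obtain ⟨i, j, k, hij, hik, hjk, rfl⟩ := Finset.card_eq_three.1 ht
  rw [Finset.prod_insert (by simp [hij, hik]), Finset.prod_insert (by simp [hjk]),
    Finset.prod_singleton, Finset.sum_insert (by simp [hij, hik]), Finset.sum_insert (by simp [hjk]),
    Finset.sum_singleton]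
  rcases hp i with h1 | h1 <;> rcases hp j with h2 | h2 <;> rcases hp k with h3 | h3 <;>
    rw [h1, h2, h3] <;> norm_num

theorem isGreatest_classicalValue {n : ℕ} (hn : 3 ≤ n) :
    IsGreatest (Set.range (classicalValue n)) (etaC n) := by
  constructor
  · refine ⟨fun _ => 1, ?_⟩
    rw [classicalValue, expr_of_values (x := 1) (by simp) (by simp) (by simp) (by simp), etaC]
    ring
  · rintro _ ⟨m, rfl⟩
    have hn' : (3 : ℝ) ≤ n := by exact_mod_cast hn
    have h' := fun c : Finset (Obs n) => abs_le.1 (abs_prod_units c m)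
    -- Only the one-A and three-A terms compete, triple by triple; the other two families are
    -- bounded trivially.
    rw [classicalValue, expr, ← sum_powersetCard_three_sum]
    have b1 : ∑ e : Edge n, ∏ a ∈ ctxABN e, ((m a : ℤ) : ℝ) ≤ n.choose 2 := by
      have := Finset.sum_le_card_nsmul Finset.univ
        (fun e : Edge n => ∏ a ∈ ctxABN e, ((m a : ℤ) : ℝ)) 1 fun e _ => (h' _).2
      simpa only [Finset.card_univ, card_edge, nsmul_eq_mul, mul_one] using this
    have b4 : ∑ t ∈ Finset.powersetCard 3 (Finset.univ : Finset (Fin n)),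
        ∑ j ∈ t, ∏ a ∈ ctxNN t j, ((m a : ℤ) : ℝ) ≤ n.choose 3 * 3 := by
      rw [← sum_powersetCard_const]
      refine Finset.sum_le_sum fun t ht => ?_
      have := Finset.sum_le_card_nsmul t
        (fun j => ∏ a ∈ ctxNN t j, ((m a : ℤ) : ℝ)) 1 fun e _ => (h' _).2
      simpa [(Finset.mem_powersetCard.1 ht).2] using this
    have b2 : ∑ t ∈ Finset.powersetCard 3 (Finset.univ : Finset (Fin n)),
        (∑ i ∈ t, ∏ a ∈ ctxAB {i}, ((m a : ℤ) : ℝ) - ∏ a ∈ ctxAB t, ((m a : ℤ) : ℝ)) ≤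
          n.choose 3 * 2 := by
      rw [← sum_powersetCard_const]
      refine Finset.sum_le_sum fun t ht => ?_
      have ht := (Finset.mem_powersetCard.1 ht).2
      rw [prod_ctxAB_eq_prod m ht]
      refine sum_sub_prod_le_two _ (fun i => ?_) ht
      rw [← Int.cast_prod, ← Units.coe_prod]
      rcases Int.units_eq_one_or (∏ a ∈ ctxAB {i}, m a) with h | h <;> simp [h]
    rw [Finset.sum_sub_distrib] at b2
    have b1' := mul_le_mul_of_nonneg_left b1 (show (0 : ℝ) ≤ n - 2 by linarith)
    rw [sub_two_mul_choose_two] at b1'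
    rw [etaC_eq]
    linarith

end Counting

/-! ### Membership in the measurement contexts -/

section Contexts

variable {n : ℕ}

@[simp] theorem A_mem_ctxAB {s : Finset (Fin n)} {k : Fin n} : Obs.A k ∈ ctxAB s ↔ k ∈ s := by
  simp only [ctxAB, Finset.mem_image, Finset.mem_univ, true_and]
  constructor
  · rintro ⟨l, hl⟩
    split_ifs at hl with h
    cases hl
    exact h
  · exact fun h => ⟨k, by simp [h]⟩

@[simp] theorem B_mem_ctxAB {s : Finset (Fin n)} {k : Fin n} : Obs.B k ∈ ctxAB s ↔ k ∉ s := by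
  simp only [ctxAB, Finset.mem_image, Finset.mem_univ, true_and]
  constructor
  · rintro ⟨l, hl⟩
    split_ifs at hl with h
    cases hl
    exact h
  · exact fun h => ⟨k, by simp [h]⟩

@[simp] theorem N_notMem_ctxAB {s : Finset (Fin n)} {e : Edge n} : Obs.N e ∉ ctxAB s := by
  simp only [ctxAB, Finset.mem_image, Finset.mem_univ, true_and]
  rintro ⟨l, hl⟩
  split_ifs at hl

@[simp] theorem A_mem_ctxABN {e : Edge n} {k : Fin n} : Obs.A k ∈ ctxABN e ↔ k ∈ e.1 := by
  simp [ctxABN]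

@[simp] theorem B_mem_ctxABN {e : Edge n} {k : Fin n} : Obs.B k ∈ ctxABN e ↔ k ∉ e.1 := by
  simp [ctxABN]

@[simp] theorem N_mem_ctxABN {e f : Edge n} : Obs.N f ∈ ctxABN e ↔ f = e := by
  simp [ctxABN]

/-- The edge between two distinct vertices. -/
def edge {i j : Fin n} (h : i ≠ j) : Edge n := ⟨s(i, j), by simpa using h⟩

@[simp] theorem mem_edge {i j k : Fin n} (h : i ≠ j) : k ∈ (edge h).1 ↔ k = i ∨ k = j := by
  simp [edge]

theorem exists_eq_edge (e : Edge n) : ∃ (i j : Fin n) (h : i ≠ j), e = edge h := by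
  obtain ⟨e, he⟩ := e
  induction e using Sym2.ind with
  | _ i j => exact ⟨i, j, by simpa using he, rfl⟩

theorem edge_comm {i j : Fin n} (h : i ≠ j) : edge h = edge h.symm :=
  Subtype.ext Sym2.eq_swap

theorem edge_ne {i j k : Fin n} (hij : i ≠ j) (hik : i ≠ k) (hjk : j ≠ k) :
    edge hij ≠ edge hik := by
  intro h
  have : j ∈ (edge hik).1 := h ▸ (by simp)
  simp [hij.symm, hjk] at this

theorem ctxNN_eq {i j k : Fin n} (hij : i ≠ j) (hik : i ≠ k) :
    ctxNN {i, j, k} i = {Obs.N (edge hij), Obs.N (edge hik)} := by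
  ext a
  simp only [ctxNN, Finset.mem_image, Finset.mem_filter, Finset.mem_univ, true_and,
    Finset.mem_insert, Finset.mem_singleton]
  constructor
  · rintro ⟨e, ⟨hi, he⟩, rfl⟩
    obtain ⟨x, y, hxy, rfl⟩ := exists_eq_edge e
    simp only [mem_edge, forall_eq_or_imp, forall_eq] at hi he
    simp only [Obs.N.injEq, edge, Subtype.mk.injEq, Sym2.eq_iff]
    grind
  · rintro (rfl | rfl)
    · exact ⟨_, ⟨by simp, by simp⟩, rfl⟩
    · exact ⟨_, ⟨by simp, by simp⟩, rfl⟩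

end Contexts

/-! ### Pauli strings and products over a context -/

section Tensor

variable {n : ℕ}

/-- `K ↦ K₁ ⊗ ⋯ ⊗ Kₙ` as a monoid homomorphism. -/
noncomputable def tensorHom :
    (Fin n → Matrix (Fin 2) (Fin 2) ℂ) →* (Qubits n →L[ℂ] Qubits n) where
  toFun := tensorOp
  map_one' := by
    rw [tensorOp, ← map_one (Matrix.toEuclideanCLM (n := Fin n → Fin 2) (𝕜 := ℂ))]
    congr 1
    ext x y
    simp only [Matrix.of_apply, Pi.one_apply, Matrix.one_apply]
    rw [Finset.prod_ite_zero]
    simp [funext_iff]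
  map_mul' K L := by
    simp only [tensorOp]
    rw [← map_mul (Matrix.toEuclideanCLM (n := Fin n → Fin 2) (𝕜 := ℂ))]
    congr 1
    ext x y
    simp only [Matrix.of_apply, Pi.mul_apply, Matrix.mul_apply, ← Finset.prod_mul_distrib]
    -- Expanding a product over sites of sums over bits gives the sum over bit strings in the matrix
    -- product.
    rw [Finset.prod_univ_sum]
    simp

theorem tensorOp_mul (K L : Fin n → Matrix (Fin 2) (Fin 2) ℂ) :
    tensorOp K * tensorOp L = tensorOp (K * L) :=
  (map_mul tensorHom K L).symm

theorem tensorOp_one : tensorOp (1 : Fin n → Matrix (Fin 2) (Fin 2) ℂ) = 1 :=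
  map_one tensorHom

theorem tensorOp_smul (c : Fin n → ℂ) (K : Fin n → Matrix (Fin 2) (Fin 2) ℂ) :
    tensorOp (fun k => c k • K k) = (∏ k, c k) • tensorOp K := by
  rw [tensorOp, tensorOp, ← map_smul]
  congr 1
  ext x y
  simp [Finset.prod_mul_distrib]

theorem isSelfAdjoint_tensorOp {K : Fin n → Matrix (Fin 2) (Fin 2) ℂ}
    (hK : ∀ k, (K k).IsHermitian) : IsSelfAdjoint (tensorOp K) := by
  rw [IsSelfAdjoint, tensorOp, ← map_star]
  congr 1
  ext x y
  simp only [Matrix.star_apply, Matrix.of_apply, star_prod]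
  exact Finset.prod_congr rfl fun k _ => (hK k).apply _ _

theorem pauliX_mul_self : pauliX * pauliX = 1 := by
  simp [pauliX, Matrix.one_fin_two]

theorem pauliZ_mul_self : pauliZ * pauliZ = 1 := by
  simp [pauliZ, Matrix.one_fin_two]

theorem pauliZ_mul_pauliX : pauliZ * pauliX = -(pauliX * pauliZ) := by
  simp [pauliZ, pauliX]

theorem isHermitian_pauliX : pauliX.IsHermitian := by
  ext i j
  fin_cases i <;> fin_cases j <;> simp [pauliX]

theorem isHermitian_pauliZ : pauliZ.IsHermitian := by
  ext i j
  fin_cases i <;> fin_cases j <;> simp [pauliZ]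

/-- The tensor factors of the reference observables. -/
noncomputable def pauliFactor : Obs n → Fin n → Matrix (Fin 2) (Fin 2) ℂ
  | .A i => fun k => if k = i then pauliX else 1
  | .B i => fun k => if k = i then pauliZ else 1
  | .N e => fun k => if k ∈ e.1 then pauliX else pauliZ

theorem pauliObs_eq (a : Obs n) : pauliObs a = tensorHom (pauliFactor a) := by
  cases a <;> rfl

theorem pauliFactor_cases (a : Obs n) (k : Fin n) :
    pauliFactor a k = 1 ∨ pauliFactor a k = pauliX ∨ pauliFactor a k = pauliZ := by
  cases a <;> simp only [pauliFactor] <;> split_ifs <;> simp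

theorem isSelfAdjoint_pauliObs (a : Obs n) : IsSelfAdjoint (pauliObs a) := by
  rw [pauliObs_eq]
  refine isSelfAdjoint_tensorOp fun k => ?_
  rcases pauliFactor_cases a k with h | h | h <;> rw [h]
  · exact Matrix.isHermitian_one
  · exact isHermitian_pauliX
  · exact isHermitian_pauliZ

theorem pauliObs_mul_self (a : Obs n) : pauliObs a * pauliObs a = 1 := by
  rw [pauliObs_eq, ← map_mul, ← map_one tensorHom]
  congr 1
  ext1 k
  rcases pauliFactor_cases a k with h | h | h <;>
    simp [h, pauliX_mul_self, pauliZ_mul_self]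

/-- `X_i` for `i ∈ s` together with `Z_k` for `k ∉ s`. -/
noncomputable def ctxFactor (s : Finset (Fin n)) (k : Fin n) : Matrix (Fin 2) (Fin 2) ℂ :=
  if k ∈ s then pauliX else pauliZ

theorem ctxFactor_mul_self (s : Finset (Fin n)) : ctxFactor s * ctxFactor s = 1 := by
  ext1 k
  simp only [Pi.mul_apply, ctxFactor, Pi.one_apply]
  split_ifs
  · exact pauliX_mul_self
  · exact pauliZ_mul_self

theorem pauliFactor_of_mem_ctxAB {s : Finset (Fin n)} {a : Obs n} (ha : a ∈ ctxAB s) (k : Fin n) :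
    pauliFactor a k = 1 ∨ pauliFactor a k = ctxFactor s k := by
  cases a with
  | A i =>
    rw [A_mem_ctxAB] at ha
    by_cases h : k = i <;> simp [pauliFactor, ctxFactor, h, ha]
  | B i =>
    rw [B_mem_ctxAB] at ha
    by_cases h : k = i <;> simp [pauliFactor, ctxFactor, h, ha]
  | N e => simp at ha

theorem pauliFactor_of_mem_ctxABN {e : Edge n} {a : Obs n} (ha : a ∈ ctxABN e) (k : Fin n) :
    pauliFactor a k = 1 ∨
      pauliFactor a k = ctxFactor (Finset.univ.filter fun k => k ∈ e.1) k := by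
  rcases Finset.mem_insert.1 ha with rfl | ha
  · simp [pauliFactor, ctxFactor]
  · exact pauliFactor_of_mem_ctxAB ha k

/-- Observables of one A-B or A-B-N context are, site by site, either trivial or equal to one common
Pauli string, so the order within the context does not matter. -/
theorem commute_of_factors {P : Fin n → Matrix (Fin 2) (Fin 2) ℂ} {a b : Obs n}
    (ha : ∀ k, pauliFactor a k = 1 ∨ pauliFactor a k = P k)
    (hb : ∀ k, pauliFactor b k = 1 ∨ pauliFactor b k = P k) :
    Commute (pauliFactor a) (pauliFactor b) := by
  refine funext fun k => ?_
  simp only [Pi.mul_apply]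
  rcases ha k with h | h <;> rcases hb k with h' | h' <;> simp [h, h']

theorem prod_ctxAB_list (s : Finset (Fin n)) :
    (((List.finRange n).map fun k => if k ∈ s then Obs.A k else Obs.B k).map pauliFactor).prod =
      ctxFactor s := by
  ext1 j
  rw [Pi.list_prod_apply, List.map_map, List.map_map]
  have : (List.finRange n).map
      (((fun f => f j) ∘ pauliFactor) ∘ fun k => if k ∈ s then Obs.A k else Obs.B k) =
      (List.finRange n).map fun k => if k = j then ctxFactor s k else 1 := by
    refine List.map_congr_left fun k _ => ?_
    simp only [Function.comp_apply, ctxFactor]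
    split_ifs <;> simp_all [pauliFactor, eq_comm]
  rw [this]
  -- At site j only the letter with index j acts nontrivially.
  have key : ∀ l : List (Fin n), l.Nodup →
      (l.map fun k => if k = j then ctxFactor s k else 1).prod =
        if j ∈ l then ctxFactor s j else 1 := by
    intro l hl
    induction l with
    | nil => simp
    | cons a l ih =>
      rw [List.nodup_cons] at hl
      rw [List.map_cons, List.prod_cons, ih hl.2]
      by_cases h : a = j
      · subst h; simp [hl.1]
      · simp [h, Ne.symm h]
  rw [key _ (List.nodup_finRange n)]
  simp

theorem isOrdering_ctxAB_list (s : Finset (Fin n)) :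
    IsOrdering (ctxAB s) ((List.finRange n).map fun k => if k ∈ s then Obs.A k else Obs.B k) := by
  constructor
  · refine (List.nodup_finRange n).map fun i j hij => ?_
    split_ifs at hij <;> simpa using hij
  · ext a
    simp [ctxAB]

theorem IsOrdering.perm {α : Type*} [DecidableEq α] {c : Finset α} {l l' : List α}
    (h : IsOrdering c l) (h' : IsOrdering c l') : l.Perm l' :=
  List.perm_of_nodup_nodup_toFinset_eq h.1 h'.1 (h.2.trans h'.2.symm)

theorem prod_pauliObs (w : List (Obs n)) :
    (w.map pauliObs).prod = tensorOp (w.map pauliFactor).prod := by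
  change _ = tensorHom _
  rw [map_list_prod, List.map_map]
  congr 2
  exact funext pauliObs_eq

theorem pairwise_commute_of_isOrdering {c : Finset (Obs n)} {w : List (Obs n)}
    (hw : IsOrdering c w) {P : Fin n → Matrix (Fin 2) (Fin 2) ℂ}
    (h : ∀ a ∈ c, ∀ k, pauliFactor a k = 1 ∨ pauliFactor a k = P k) :
    (w.map pauliFactor).Pairwise Commute := by
  rw [List.pairwise_map]
  refine List.pairwise_of_forall_mem_list fun a ha b hb => ?_
  exact commute_of_factors (h a (by simpa [← hw.2] using ha)) (h b (by simpa [← hw.2] using hb))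

theorem prod_pauliObs_ctxAB {s : Finset (Fin n)} {w : List (Obs n)} (hw : IsOrdering (ctxAB s) w) :
    (w.map pauliObs).prod = tensorOp (ctxFactor s) := by
  rw [prod_pauliObs, ← prod_ctxAB_list]
  congr 1
  exact ((hw.perm (isOrdering_ctxAB_list s)).map _).prod_eq'
    (pairwise_commute_of_isOrdering hw fun a ha => pauliFactor_of_mem_ctxAB ha)

/-- N_e is itself the product of the other letters, a Pauli string of square one. -/
theorem prod_pauliObs_ctxABN {e : Edge n} {w : List (Obs n)} (hw : IsOrdering (ctxABN e) w) :
    (w.map pauliObs).prod = 1 := by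
  set s := Finset.univ.filter fun k => k ∈ e.1 with hs
  have hl := isOrdering_ctxAB_list s
  have hl' : IsOrdering (ctxABN e)
      (Obs.N e :: (List.finRange n).map fun k => if k ∈ s then Obs.A k else Obs.B k) := by
    constructor
    · refine List.nodup_cons.2 ⟨fun h => ?_, hl.1⟩
      rw [← List.mem_toFinset, hl.2] at h
      simp at h
    · rw [List.toFinset_cons, hl.2]; rfl
  have hN : pauliFactor (Obs.N e) = ctxFactor s := by
    ext1 k
    simp [pauliFactor, ctxFactor, hs]
  rw [prod_pauliObs, ((hw.perm hl').map _).prod_eq'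
    (pairwise_commute_of_isOrdering hw fun a ha => pauliFactor_of_mem_ctxABN ha),
    List.map_cons, List.prod_cons, prod_ctxAB_list, hN, ctxFactor_mul_self, tensorOp_one]

end Tensor

/-! ### The complete-graph state and the value of the reference experiment -/

section GraphState

variable {n : ℕ}

/-- The sign `(-1) ^ b` of a bit `b`. -/
def bitSign (b : Fin 2) : ℂ := if b = 1 then -1 else 1

/-- Flip the `i`-th bit. -/
def flipBit (x : Fin n → Fin 2) (i : Fin n) : Fin n → Fin 2 := Function.update x i (x i + 1)

theorem pauliX_apply (a b : Fin 2) : pauliX a b = if b = a + 1 then 1 else 0 := by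
  fin_cases a <;> fin_cases b <;> simp [pauliX]

theorem pauliZ_apply (a b : Fin 2) : pauliZ a b = if b = a then bitSign a else 0 := by
  fin_cases a <;> fin_cases b <;> simp [pauliZ, bitSign]

theorem tensorOp_ctxFactor_singleton_apply (i : Fin n) (φ : Qubits n) (x : Fin n → Fin 2) :
    tensorOp (ctxFactor {i}) φ x =
      (∏ k, if k = i then 1 else bitSign (x k)) * φ (flipBit x i) := by
  rw [tensorOp, Matrix.ofLp_toEuclideanCLM, Matrix.mulVec, dotProduct,
    Finset.sum_eq_single (flipBit x i)]
  · rw [Matrix.of_apply]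
    congr 1
    refine Finset.prod_congr rfl fun k _ => ?_
    by_cases h : k = i
    · subst h; simp [ctxFactor, flipBit, pauliX_apply]
    · simp [ctxFactor, flipBit, pauliZ_apply, h]
  · intro y _ hy
    obtain ⟨k, hk⟩ := Function.ne_iff.1 hy
    rw [Matrix.of_apply, Finset.prod_eq_zero (Finset.mem_univ k), zero_mul]
    by_cases h : k = i
    · subst h; simpa [ctxFactor, flipBit, pauliX_apply] using hk
    · rw [flipBit, Function.update_of_ne h] at hk
      simp [ctxFactor, pauliZ_apply, h, hk]
  · simp

/-- `(-1) ^ #{i < j : x_i = x_j = 1}`. -/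
noncomputable def pairSign (x : Fin n → Fin 2) : ℂ :=
  ∏ i : Fin n, ∏ j ∈ Finset.Ioi i, if x i = 1 ∧ x j = 1 then (-1 : ℂ) else 1

theorem completeGraphState_apply (x : Fin n → Fin 2) :
    completeGraphState n x = ((Real.sqrt 2 : ℂ)⁻¹) ^ n * pairSign x := rfl

theorem pairSign_eq_or (x : Fin n → Fin 2) : pairSign x = 1 ∨ pairSign x = -1 := by
  have h : pairSign x * pairSign x = 1 := by
    simp only [pairSign, ← Finset.prod_mul_distrib]
    refine Finset.prod_eq_one fun i _ => Finset.prod_eq_one fun j _ => ?_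
    split_ifs <;> simp
  exact mul_self_eq_one_iff.1 h

theorem pairSign_mul_self (x : Fin n → Fin 2) : pairSign x * pairSign x = 1 :=
  mul_self_eq_one_iff.2 (pairSign_eq_or x)

/-- Flipping bit i affects only the pairs {i, k}, and such a pair changes sign exactly when x_k = 1.
-/
theorem pairSign_mul_pairSign_flipBit (x : Fin n → Fin 2) (i : Fin n) :
    pairSign x * pairSign (flipBit x i) = ∏ k, if k = i then 1 else bitSign (x k) := by
  have key : ∀ a b : Fin n, a < b →
      ((if x a = 1 ∧ x b = 1 then (-1 : ℂ) else 1) *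
        if flipBit x i a = 1 ∧ flipBit x i b = 1 then (-1 : ℂ) else 1) =
      if a = i then bitSign (x b) else if b = i then bitSign (x a) else 1 := by
    intro a b hab
    by_cases ha : a = i
    · subst ha
      have hb : b ≠ a := hab.ne'
      generalize hxa : x a = p
      generalize hxb : x b = q
      fin_cases p <;> fin_cases q <;> simp [flipBit, bitSign, hb, hxa, hxb]
    by_cases hb : b = i
    · subst hb
      generalize hxa : x a = p
      generalize hxb : x b = q
      fin_cases p <;> fin_cases q <;> simp [flipBit, bitSign, ha, hxa, hxb]
    · simp only [flipBit, ha, hb, if_false, ne_eq, not_false_eq_true, Function.update_of_ne]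
      split_ifs <;> simp
  -- With pairs ordered a < b, partners below i each appear in their own row, while all partners
  -- above i appear in row i.
  have row : ∀ a : Fin n, (∏ b ∈ Finset.Ioi a,
      if a = i then bitSign (x b) else if b = i then bitSign (x a) else 1) =
      (if a < i then bitSign (x a) else 1) *
        if a = i then ∏ b, if i < b then bitSign (x b) else 1 else 1 := by
    intro a
    by_cases ha : a = i
    · subst ha
      simp only [if_true, lt_self_iff_false, if_false, one_mul]
      rw [← Finset.prod_filter]
      refine Finset.prod_congr ?_ fun _ _ => rfl
      ext; simp
    · simp [ha]
  simp only [pairSign, ← Finset.prod_mul_distrib]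
  rw [Finset.prod_congr rfl fun a _ => (Finset.prod_congr rfl fun b hb =>
    key a b (Finset.mem_Ioi.1 hb)).trans (row a), Finset.prod_mul_distrib, Finset.prod_ite_eq']
  simp only [Finset.mem_univ, if_true, ← Finset.prod_mul_distrib]
  refine Finset.prod_congr rfl fun k _ => ?_
  rcases lt_trichotomy k i with h | h | h
  · simp [h, h.ne, h.not_gt]
  · simp [h]
  · simp [h, h.ne', h.not_gt]

theorem tensorOp_ctxFactor_singleton_completeGraphState (i : Fin n) :
    tensorOp (ctxFactor {i}) (completeGraphState n) = completeGraphState n := by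
  ext x
  rw [tensorOp_ctxFactor_singleton_apply, completeGraphState_apply, completeGraphState_apply,
    ← pairSign_mul_pairSign_flipBit]
  linear_combination ((Real.sqrt 2 : ℂ)⁻¹) ^ n * pairSign x * pairSign_mul_self (flipBit x i)

theorem norm_completeGraphState (n : ℕ) : ‖completeGraphState n‖ = 1 := by
  have h : ∀ x : Fin n → Fin 2, ‖completeGraphState n x‖ ^ 2 = (2⁻¹ : ℝ) ^ n := by
    intro x
    have hs : ‖pairSign x‖ = 1 := by rcases pairSign_eq_or x with h | h <;> simp [h]
    rw [completeGraphState_apply, norm_mul, hs, mul_one, norm_pow, ← pow_mul, mul_comm, pow_mul,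
      norm_inv, Complex.norm_real, Real.norm_of_nonneg (Real.sqrt_nonneg 2), inv_pow,
      Real.sq_sqrt (by norm_num)]
  rw [EuclideanSpace.norm_eq, Finset.sum_congr rfl fun x _ => h x]
  simp

theorem isGraphState_top_iff {φ : Qubits n} :
    IsGraphState ⊤ φ ↔ ‖φ‖ = 1 ∧ ∀ i, tensorOp (ctxFactor {i}) φ = φ := by
  classical
  unfold IsGraphState
  refine and_congr_right fun _ => forall_congr' fun i => ?_
  rw [iff_eq_eq]
  congr 3
  ext1 k
  by_cases h : k = i
  · simp [ctxFactor, h]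
  · simp [ctxFactor, h, Ne.symm h]

theorem isGraphState_completeGraphState : IsGraphState ⊤ (completeGraphState n) :=
  isGraphState_top_iff.2
    ⟨norm_completeGraphState n, tensorOp_ctxFactor_singleton_completeGraphState⟩

theorem eq_of_flipBit_invariant {β : Type*} (r : (Fin n → Fin 2) → β)
    (h : ∀ x i, r (flipBit x i) = r x) (x : Fin n → Fin 2) : r x = r 0 := by
  have hu : ∀ x i b, r (Function.update x i b) = r x := by
    intro x i b
    by_cases hb : b = x i
    · simp [hb]
    · have : b = x i + 1 := by
        generalize x i = p at hb
        fin_cases b <;> fin_cases p <;> simp_all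
      rw [this]
      exact h x i
  have hs : ∀ s : Finset (Fin n), r (s.piecewise x 0) = r 0 := by
    intro s
    induction s using Finset.induction_on with
    | empty => simp
    | insert i s _ ih => rw [Finset.piecewise_insert, hu, ih]
  simpa using hs Finset.univ

/-- The stabilizer equations say that `pairSign x * φ x` is unchanged by every bit flip, and flips
connect all bit strings; so all amplitudes are fixed by the one at 0. -/
theorem exists_phase_of_isGraphState {φ : Qubits n} (hφ : IsGraphState ⊤ φ) :
    ∃ z : ℂ, ‖z‖ = 1 ∧ φ = z • completeGraphState n := by
  obtain ⟨hnorm, hst⟩ := isGraphState_top_iff.1 hφ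
  have hinv : ∀ x i, pairSign (flipBit x i) * φ (flipBit x i) = pairSign x * φ x := by
    intro x i
    have hx := tensorOp_ctxFactor_singleton_apply i φ x
    rw [hst i, ← pairSign_mul_pairSign_flipBit] at hx
    rw [hx]
    linear_combination -pairSign (flipBit x i) * φ (flipBit x i) * pairSign_mul_self x
  have hconst := eq_of_flipBit_invariant (fun x => pairSign x * φ x) hinv
  have hc : ((Real.sqrt 2 : ℂ)⁻¹) ^ n ≠ 0 := by simp
  set z := (((Real.sqrt 2 : ℂ)⁻¹) ^ n)⁻¹ * (pairSign 0 * φ 0) with hz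
  have hφz : φ = z • completeGraphState n := by
    ext x
    rw [PiLp.smul_apply, completeGraphState_apply, smul_eq_mul, hz, ← hconst x]
    dsimp only
    field_simp
    linear_combination -φ x * pairSign_mul_self x
  refine ⟨z, ?_, hφz⟩
  rw [hφz, norm_smul, norm_completeGraphState, mul_one] at hnorm
  exact hnorm

theorem isRealization_pauliObs : IsRealization (completeGraphState n) (pauliObs (n := n)) :=
  ⟨norm_completeGraphState n, isSelfAdjoint_pauliObs, pauliObs_mul_self⟩

/-- The sign comes from site j alone: XZZ = X at i, ZXZ = -X at j, ZZX = X at k, and ZZZ = Z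
elsewhere. -/
theorem ctxFactor_mul_mul {i j k : Fin n} (hij : i ≠ j) (hik : i ≠ k) (hjk : j ≠ k) :
    tensorOp (ctxFactor {i}) * tensorOp (ctxFactor {j}) * tensorOp (ctxFactor {k}) =
      -tensorOp (ctxFactor {i, j, k}) := by
  have : ctxFactor {i} * ctxFactor {j} * ctxFactor {k} =
      fun l => (if l = j then (-1 : ℂ) else 1) • ctxFactor {i, j, k} l := by
    ext1 l
    by_cases h1 : l = i
    · subst h1; simp [ctxFactor, hij, hik, mul_assoc, pauliZ_mul_self]
    by_cases h2 : l = j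
    · subst h2
      simp [ctxFactor, h1, hjk, pauliZ_mul_pauliX, mul_assoc, pauliZ_mul_self]
    by_cases h3 : l = k
    · subst h3; simp [ctxFactor, h1, h2, pauliZ_mul_self]
    · simp [ctxFactor, h1, h2, h3, pauliZ_mul_self]
  rw [tensorOp_mul, tensorOp_mul, this, tensorOp_smul, Finset.prod_ite_eq', if_pos (by simp)]
  ext φ x
  simp

/-- N_ij differs from the stabilizer of j only by X in place of Z at site i, and XX = ZZ there.
Hence N_ij N_ik fixes the graph state. -/
theorem pauliObs_edge_mul {i j k : Fin n} (hij : i ≠ j) (hik : i ≠ k) :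
    pauliObs (Obs.N (edge hij)) * pauliObs (Obs.N (edge hik)) =
      tensorOp (ctxFactor {j}) * tensorOp (ctxFactor {k}) := by
  change tensorOp _ * tensorOp _ = _
  rw [tensorOp_mul, tensorOp_mul]
  congr 1
  ext1 l
  simp only [Pi.mul_apply, ctxFactor, mem_edge, Finset.mem_singleton]
  by_cases h1 : l = i
  · subst h1; simp [hij, hik, pauliX_mul_self, pauliZ_mul_self]
  · simp [h1]

theorem isOrdering_pair {α : Type*} [DecidableEq α] {a b : α} {w : List α} (hab : a ≠ b)
    (hw : IsOrdering {a, b} w) : w = [a, b] ∨ w = [b, a] := by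
  have h := hw.perm (l' := [a, b]) ⟨by simpa using hab, by simp⟩
  obtain ⟨x, y, rfl⟩ := List.length_eq_two.1 h.length_eq
  have hx := h.mem_iff (a := x)
  have hy := h.mem_iff (a := y)
  have hxy : x ≠ y := by simpa using hw.1
  simp only [List.mem_cons, List.not_mem_nil, or_false, true_or, or_true, true_iff] at hx hy
  grind

theorem temporalValue_pauliObs (π : ∀ c : Finset (Obs n), PermScheme c) :
    temporalValue π (completeGraphState n) (pauliObs (n := n)) = etaQ n := by
  have hR := isRealization_pauliObs (n := n)
  rw [temporalValue, expr_of_values (x := -1), etaQ]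
  · ring
  · intro e
    simpa using hR.piCorr_eq_of_words (π (ctxABN e)) 1 fun w hw => by
      simp [prod_pauliObs_ctxABN hw]
  · intro i
    simpa using hR.piCorr_eq_of_words (π (ctxAB {i})) 1 fun w hw => by
      simp [prod_pauliObs_ctxAB hw, tensorOp_ctxFactor_singleton_completeGraphState]
  · intro t ht
    simpa using hR.piCorr_eq_of_words (π (ctxAB t)) (-1) fun w hw => by
      obtain ⟨i, j, k, hij, hik, hjk, rfl⟩ := Finset.card_eq_three.1 ht
      rw [prod_pauliObs_ctxAB hw, ← neg_neg (tensorOp _), ← ctxFactor_mul_mul hij hik hjk]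
      simp [tensorOp_ctxFactor_singleton_completeGraphState]
  · intro t ht l hl
    obtain ⟨j, k, hlj, hlk, hjk, rfl⟩ : ∃ j k, l ≠ j ∧ l ≠ k ∧ j ≠ k ∧ t = {l, j, k} := by
      have : (t.erase l).card = 2 := by rw [Finset.card_erase_of_mem hl, ht]
      obtain ⟨j, k, hjk, h⟩ := Finset.card_eq_two.1 this
      have hj : j ∈ t.erase l := by simp [h]
      have hk : k ∈ t.erase l := by simp [h]
      refine ⟨j, k, (Finset.ne_of_mem_erase hj).symm, (Finset.ne_of_mem_erase hk).symm, hjk, ?_⟩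
      rw [← h, Finset.insert_erase hl]
    simpa using hR.piCorr_eq_of_words (π (ctxNN {l, j, k} l)) 1 fun w hw => by
      rw [ctxNN_eq hlj hlk] at hw
      rcases isOrdering_pair (by simpa using edge_ne hlj hlk hjk) hw with rfl | rfl
      · rw [List.map_cons, List.map_singleton, List.prod_pair, pauliObs_edge_mul hlj hlk]
        simp [tensorOp_ctxFactor_singleton_completeGraphState]
      · rw [List.map_cons, List.map_singleton, List.prod_pair, pauliObs_edge_mul hlk hlj]
        simp [tensorOp_ctxFactor_singleton_completeGraphState]

end GraphState

/-! ### Word relations forced by extremal correlators -/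

section Extremal

variable {n : ℕ} {H : Type*} [NormedAddCommGroup H] [InnerProductSpace ℂ H]
  {ψ : H} {M : Obs n → H →L[ℂ] H}

/-- A realization in which all words of the correlators act on the state as they have to when
the correlators are extremal. -/
structure IsExtremal [CompleteSpace H] (ψ : H) (M : Obs n → H →L[ℂ] H) : Prop
    extends IsRealization ψ M where
  ctxABN_word : ∀ e w, IsOrdering (ctxABN e) w → (w.map M).prod ψ = ψ
  ctxAB_one_word : ∀ i w, IsOrdering (ctxAB {i}) w → (w.map M).prod ψ = ψ
  ctxAB_three_word : ∀ t : Finset (Fin n), t.card = 3 →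
    ∀ w, IsOrdering (ctxAB t) w → (w.map M).prod ψ = -ψ
  ctxNN_word : ∀ t : Finset (Fin n), t.card = 3 → ∀ j ∈ t,
    ∀ w, IsOrdering (ctxNN t j) w → (w.map M).prod ψ = ψ

theorem IsRealization.isExtremal [CompleteSpace H] (hn : 3 ≤ n)
    (π : ∀ c : Finset (Obs n), PermScheme c)
    (h : IsRealization ψ M) (hT : temporalValue π ψ M = etaQ n) : IsExtremal ψ M := by
  obtain ⟨h1, h2, h3, h4⟩ :=
    values_of_expr_eq_etaQ hn (fun c => h.abs_piCorr_le (π c)) hT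
  refine ⟨h, fun e w hw => ?_, fun i w hw => ?_, fun t ht w hw => ?_, fun t ht j hj w hw => ?_⟩
  · simpa using h.word_apply_of_piCorr_eq (π (ctxABN e)) 1 (by simpa using h1 e) hw
  · simpa using h.word_apply_of_piCorr_eq (π (ctxAB {i})) 1 (by simpa using h2 i) hw
  · simpa using h.word_apply_of_piCorr_eq (π (ctxAB t)) (-1) (by simpa using h3 t ht) hw
  · simpa using h.word_apply_of_piCorr_eq (π (ctxNN t j)) 1 (by simpa using h4 t ht j hj) hw

/-- The product of the `B_i` along a list, as an operator. -/
noncomputable def bWord (M : Obs n → H →L[ℂ] H) (l : List (Fin n)) : H →L[ℂ] H :=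
  (l.map fun i => M (.B i)).prod

@[simp] theorem bWord_nil (v : H) : bWord M [] v = v := by simp [bWord]

@[simp] theorem bWord_cons (i : Fin n) (l : List (Fin n)) (v : H) :
    bWord M (i :: l) v = M (.B i) (bWord M l v) := by simp [bWord]

@[simp] theorem prod_map_map_B (l : List (Fin n)) :
    ((l.map Obs.B).map M).prod = bWord M l := by
  simp [bWord, Function.comp_def]

theorem wordB_empty : wordB ψ M ∅ = ψ := by
  simp [wordB]

theorem wordB_mem_invSubspace (s : Finset (Fin n)) : wordB ψ M s ∈ invSubspace ψ M :=
  Submodule.subset_span ⟨s, rfl⟩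

theorem isOrdering_of_perm {α : Type*} [DecidableEq α] {c : Finset α} {l l' : List α}
    (hl : IsOrdering c l) (h : l'.Perm l) : IsOrdering c l' :=
  ⟨h.nodup_iff.2 hl.1, by rw [List.toFinset_eq_of_perm _ _ h, hl.2]⟩

theorem isOrdering_iff {α : Type*} [DecidableEq α] {c : Finset α} {l : List α} :
    IsOrdering c l ↔ l.Nodup ∧ ∀ a, a ∈ l ↔ a ∈ c := by
  simp [IsOrdering, Finset.ext_iff]

theorem injective_obsB : Function.Injective (Obs.B : Fin n → Obs n) := fun i j h => by
  simpa using h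

theorem isOrdering_ctxAB_one {i : Fin n} {l : List (Fin n)} (hl : l.Nodup)
    (hm : ∀ k, k ∈ l ↔ k ≠ i) : IsOrdering (ctxAB {i}) (Obs.A i :: l.map Obs.B) := by
  rw [isOrdering_iff]
  refine ⟨by simp [hl.map injective_obsB], fun a => ?_⟩
  cases a <;> simp [hm]

theorem isOrdering_ctxAB_three {i j k : Fin n} (hij : i ≠ j) (hik : i ≠ k) (hjk : j ≠ k)
    {l : List (Fin n)} (hl : l.Nodup) (hm : ∀ x, x ∈ l ↔ x ≠ i ∧ x ≠ j ∧ x ≠ k) :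
    IsOrdering (ctxAB {i, j, k}) (Obs.A i :: Obs.A j :: Obs.A k :: l.map Obs.B) := by
  rw [isOrdering_iff]
  refine ⟨by simp [hl.map injective_obsB, hij, hik, hjk], fun a => ?_⟩
  cases a <;> simp [hm]

theorem isOrdering_ctxABN {i j : Fin n} (hij : i ≠ j)
    {l : List (Fin n)} (hl : l.Nodup) (hm : ∀ x, x ∈ l ↔ x ≠ i ∧ x ≠ j) :
    IsOrdering (ctxABN (edge hij)) (Obs.N (edge hij) :: Obs.A i :: Obs.A j :: l.map Obs.B) := by
  rw [isOrdering_iff]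
  refine ⟨by simp [hl.map injective_obsB, hij], fun a => ?_⟩
  cases a <;> simp [hm]

end Extremal

/-! ### Action of the observables on the vectors B_s ψ -/

section Action

variable {n : ℕ} {H : Type*} [NormedAddCommGroup H] [InnerProductSpace ℂ H] [CompleteSpace H]
  {ψ : H} {M : Obs n → H →L[ℂ] H}

theorem IsRealization.bWord_injective (h : IsRealization ψ M) (l : List (Fin n)) :
    Function.Injective (bWord M l) := by
  induction l with
  | nil => exact fun v w => by simp
  | cons i l ih =>
    intro v w hvw
    simp only [bWord_cons] at hvw
    exact ih (h.injective _ hvw)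

theorem IsExtremal.A_word (h : IsExtremal ψ M) {i : Fin n} {l l' : List (Fin n)}
    (hl : (l ++ l').Nodup) (hm : ∀ k, k ∈ l ++ l' ↔ k ≠ i) :
    bWord M l (M (.A i) (bWord M l' ψ)) = ψ := by
  have := h.ctxAB_one_word i (l.map Obs.B ++ Obs.A i :: l'.map Obs.B)
    (isOrdering_of_perm (isOrdering_ctxAB_one hl hm)
      (by rw [List.map_append]; exact List.perm_middle))
  simpa only [List.map_append, List.map_cons, List.prod_append, List.prod_cons, prod_map_map_B,
    mul_apply_eq_comp] using this

theorem IsExtremal.bWord_eq_A (h : IsExtremal ψ M) {i : Fin n} {l : List (Fin n)}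
    (hl : l.Nodup) (hm : ∀ k, k ∈ l ↔ k ≠ i) : bWord M l ψ = M (.A i) ψ := by
  have := h.A_word (l := []) (l' := l) (i := i) (by simpa using hl) (by simpa using hm)
  rw [bWord_nil] at this
  conv_rhs => rw [← this]
  rw [h.apply_apply]

theorem IsExtremal.N_apply_eq (h : IsExtremal ψ M) {i j k : Fin n} (hij : i ≠ j) (hik : i ≠ k)
    (hjk : j ≠ k) : M (.N (edge hij)) ψ = M (.N (edge hik)) ψ := by
  have := h.ctxNN_word {i, j, k} (by rw [Finset.card_eq_three]; exact ⟨i, j, k, hij, hik, hjk, rfl⟩)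
    i (by simp) [.N (edge hij), .N (edge hik)] (by
      rw [ctxNN_eq hij hik]
      exact ⟨by simpa using edge_ne hij hik hjk, by simp⟩)
  simp only [List.map_cons, List.map_nil, List.prod_cons, List.prod_nil, mul_one,
    mul_apply_eq_comp] at this
  conv_lhs => rw [← this]
  rw [h.apply_apply]

/-- Words in which `N_ij`, `A_i`, `A_j` and the `B_k` occur once each. -/
theorem IsExtremal.N_word (h : IsExtremal ψ M) {i j : Fin n} (hij : i ≠ j)
    {p q : Finset (Fin n)} (hd : Disjoint p q) (hu : ∀ x, x ∈ p ∨ x ∈ q ↔ x ≠ i ∧ x ≠ j)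
    {w : List (Obs n)} (hw : w.Perm (.N (edge hij) :: .A i :: .A j ::
      (p.toList.map Obs.B ++ q.toList.map Obs.B))) : (w.map M).prod ψ = ψ := by
  refine h.ctxABN_word (edge hij) _ (isOrdering_of_perm ?_ hw)
  rw [← List.map_append]
  refine isOrdering_ctxABN hij ?_ (by simpa using hu)
  rw [List.nodup_append']
  refine ⟨p.nodup_toList, q.nodup_toList, ?_⟩
  intro x hx hy
  exact Finset.disjoint_left.1 hd (by simpa using hx) (by simpa using hy)

/-- Two words share the tail v = B_r A_i A_j ψ, where r is the complement of {i, j, k}: A_k v = -ψ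
and N_ij B_k v = ψ. Eliminating v gives the claim. -/
theorem IsExtremal.N_eq_neg_B_A (h : IsExtremal ψ M) {i j k : Fin n} (hij : i ≠ j) (hik : i ≠ k)
    (hjk : j ≠ k) : M (.N (edge hij)) ψ = -M (.B k) (M (.A k) ψ) := by
  set r : Finset (Fin n) := {i, j, k}ᶜ with hr
  have h1 := h.ctxAB_three_word {i, j, k}
    (by rw [Finset.card_eq_three]; exact ⟨i, j, k, hij, hik, hjk, rfl⟩)
    (.A k :: (r.toList.map Obs.B ++ [.A i, .A j]))
    (isOrdering_of_perm (isOrdering_ctxAB_three hij hik hjk r.nodup_toList (by simp [hr]))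
      (List.perm_iff_count.2 fun a => by
        simp only [List.count_append, List.count_cons, List.count_nil]; omega))
  have h2 := h.ctxABN_word (edge hij)
    (.N (edge hij) :: ((k :: r.toList).map Obs.B ++ [.A i, .A j]))
    (isOrdering_of_perm (isOrdering_ctxABN hij (l := k :: r.toList)
      (List.nodup_cons.2 ⟨by simp [hr], r.nodup_toList⟩)
      (by intro x; simp [hr]; grind))
      (List.perm_iff_count.2 fun a => by
        simp only [List.count_append, List.count_cons, List.count_nil]; omega))
  simp only [List.map_append, List.map_cons, List.prod_append, List.prod_cons, List.map_nil,
    List.prod_nil, prod_map_map_B, mul_apply_eq_comp, one_apply_eq_self] at h1 h2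
  have h1' := congrArg (M (.A k)) h1
  have h2' := congrArg (M (.N (edge hij))) h2
  rw [h.apply_apply] at h1' h2'
  rw [← h2', h1', map_neg, map_neg]

theorem exists_ne_ne (hn : 3 ≤ n) (i j : Fin n) : ∃ k : Fin n, i ≠ k ∧ j ≠ k := by
  have : ({i, j} : Finset (Fin n)).card < (Finset.univ : Finset (Fin n)).card := by
    have := Finset.card_le_two (a := i) (b := j)
    simp only [Finset.card_univ, Fintype.card_fin]
    omega
  obtain ⟨k, -, hk⟩ := Finset.exists_mem_notMem_of_card_lt_card this
  simp only [Finset.mem_insert, Finset.mem_singleton, not_or] at hk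
  exact ⟨k, Ne.symm hk.1, Ne.symm hk.2⟩

/-- With a third index i, N_il ψ = -B_k A_k ψ and N_ik ψ = -B_l A_l ψ, while the N-N correlators
identify the two left sides. -/
theorem IsExtremal.B_A_eq (h : IsExtremal ψ M) (hn : 3 ≤ n) (k l : Fin n) :
    M (.B k) (M (.A k) ψ) = M (.B l) (M (.A l) ψ) := by
  by_cases hkl : k = l
  · rw [hkl]
  obtain ⟨i, hki, hli⟩ := exists_ne_ne hn k l
  have h1 := h.N_eq_neg_B_A hli.symm hki.symm (Ne.symm hkl)
  have h2 := h.N_eq_neg_B_A hki.symm hli.symm hkl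
  rw [h.N_apply_eq hki.symm hli.symm hkl, h1] at h2
  exact neg_injective h2

theorem IsExtremal.bWord_perm (h : IsExtremal ψ M) (hn : 3 ≤ n) {l l' : List (Fin n)}
    (hl : l.Nodup) (hp : l.Perm l') : bWord M l ψ = bWord M l' ψ := by
  have hl' := hp.nodup_iff.1 hl
  by_cases hf : ∀ k, k ∈ l
  -- For a full list with head k, the tail acts on ψ as A_k, so the value is B_k A_k ψ, which is
  -- independent of k.
  · have key : ∀ l : List (Fin n), l.Nodup → (∀ k, k ∈ l) →
        ∃ k, bWord M l ψ = M (.B k) (M (.A k) ψ) := by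
      intro l hl hf
      cases l with
      | nil => exact absurd (hf ⟨0, by omega⟩) (by simp)
      | cons k l =>
        rw [List.nodup_cons] at hl
        refine ⟨k, ?_⟩
        rw [bWord_cons, h.bWord_eq_A hl.2]
        intro x
        have := hf x
        rw [List.mem_cons] at this
        grind
    obtain ⟨k, hk⟩ := key l hl hf
    obtain ⟨k', hk'⟩ := key l' hl' fun k => hp.mem_iff.1 (hf k)
    rw [hk, hk', h.B_A_eq hn k k']
  · push Not at hf
    obtain ⟨i, hi⟩ := hf
    have hi' : i ∉ l' := fun hc => hi (hp.mem_iff.2 hc)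
    -- If i is missing, prefixing B_r A_i turns either ordering into a one-A word with value ψ, and
    -- the common prefix is injective.
    set r : Finset (Fin n) := (insert i l.toFinset)ᶜ with hr
    have aux : ∀ l'' : List (Fin n), l''.Nodup → l.Perm l'' →
        bWord M r.toList (M (.A i) (bWord M l'' ψ)) = ψ := by
      intro l'' hl'' hp''
      refine h.A_word ?_ fun k => ?_
      · rw [List.nodup_append']
        refine ⟨r.nodup_toList, hl'', fun x hx hy => ?_⟩
        have := hp''.mem_iff.2 hy
        simp [hr] at hx
        exact hx.2 this
      · simp only [List.mem_append, Finset.mem_toList, hr, Finset.mem_compl, Finset.mem_insert,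
          List.mem_toFinset, ← hp''.mem_iff]
        grind
    exact h.injective _ (h.bWord_injective _ ((aux l hl (List.Perm.refl l)).trans
      (aux l' hl' hp).symm))

theorem IsExtremal.bWord_eq_wordB (h : IsExtremal ψ M) (hn : 3 ≤ n) {l : List (Fin n)}
    (hl : l.Nodup) {s : Finset (Fin n)} (hs : ∀ k, k ∈ l ↔ k ∈ s) :
    bWord M l ψ = wordB ψ M s := by
  refine h.bWord_perm hn hl ?_
  rw [List.perm_ext_iff_of_nodup hl ((List.nodup_finRange n).filter _)]
  simpa using hs

theorem IsExtremal.bWord_toList (h : IsExtremal ψ M) (hn : 3 ≤ n) (s : Finset (Fin n)) :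
    bWord M s.toList ψ = wordB ψ M s :=
  h.bWord_eq_wordB hn s.nodup_toList (by simp)

theorem IsExtremal.B_wordB (h : IsExtremal ψ M) (hn : 3 ≤ n) (i : Fin n) (s : Finset (Fin n)) :
    M (.B i) (wordB ψ M s) = wordB ψ M (symmDiff {i} s) := by
  have key : ∀ s : Finset (Fin n), i ∉ s → M (.B i) (wordB ψ M s) = wordB ψ M (insert i s) := by
    intro s hi
    rw [← h.bWord_toList hn, ← bWord_cons]
    exact h.bWord_eq_wordB hn (List.nodup_cons.2 ⟨by simpa using hi, s.nodup_toList⟩) (by simp)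
  by_cases hi : i ∈ s
  · have := key (s.erase i) (by simp)
    rw [Finset.insert_erase hi] at this
    rw [← this, h.apply_apply]
    congr 1
    ext x
    simp only [Finset.mem_symmDiff, Finset.mem_erase, Finset.mem_singleton]
    grind
  · rw [key s hi]
    congr 1
    ext x
    simp only [Finset.mem_symmDiff, Finset.mem_insert, Finset.mem_singleton]
    grind

theorem IsExtremal.bWord_wordB (h : IsExtremal ψ M) (hn : 3 ≤ n) (p s : Finset (Fin n)) :
    bWord M p.toList (wordB ψ M s) = wordB ψ M (symmDiff p s) := by
  have key : ∀ l : List (Fin n), l.Nodup →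
      bWord M l (wordB ψ M s) = wordB ψ M (symmDiff l.toFinset s) := by
    intro l hl
    induction l with
    | nil => rw [bWord_nil, List.toFinset_nil, ← Finset.bot_eq_empty, bot_symmDiff]
    | cons i l ih =>
      rw [List.nodup_cons] at hl
      rw [bWord_cons, ih hl.2, h.B_wordB hn, ← symmDiff_assoc]
      congr 2
      ext x
      simp only [Finset.mem_symmDiff, Finset.mem_singleton, List.mem_toFinset, List.mem_cons]
      grind
  rw [key _ p.nodup_toList, Finset.toList_toFinset]

/-- Cancellation of a product of `B`s. -/
theorem IsExtremal.eq_of_bWord_eq (h : IsExtremal ψ M) (hn : 3 ≤ n) {p s : Finset (Fin n)} {v : H}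
    (hv : bWord M p.toList v = wordB ψ M s) : v = wordB ψ M (symmDiff p s) := by
  refine h.bWord_injective p.toList ?_
  rw [hv, h.bWord_wordB hn, symmDiff_symmDiff_cancel_left]

theorem IsExtremal.eq_neg_of_bWord_eq (h : IsExtremal ψ M) (hn : 3 ≤ n) {p s : Finset (Fin n)}
    {v : H} (hv : bWord M p.toList v = -wordB ψ M s) : v = -wordB ψ M (symmDiff p s) := by
  rw [eq_neg_iff_add_eq_zero, ← neg_eq_iff_add_eq_zero]
  exact h.eq_of_bWord_eq hn (by rw [map_neg, hv, neg_neg])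

/-- Place A_i inside the one-A word: B_p A_i B_s ψ = ψ for the complementary p; then cancel B_p. -/
theorem IsExtremal.A_wordB_of_notMem (h : IsExtremal ψ M) (hn : 3 ≤ n) {i : Fin n}
    {s : Finset (Fin n)} (hi : i ∉ s) :
    M (.A i) (wordB ψ M s) = wordB ψ M (insert i s)ᶜ := by
  set p : Finset (Fin n) := (insert i s)ᶜ with hp
  have := h.A_word (i := i) (l := p.toList) (l' := s.toList)
    (by
      rw [List.nodup_append']
      refine ⟨p.nodup_toList, s.nodup_toList, fun x hx hy => ?_⟩
      simp [hp] at hx hy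
      exact hx.2 hy)
    (by intro k; simp only [hp, List.mem_append, Finset.mem_toList, Finset.mem_compl,
          Finset.mem_insert]; grind)
  rw [h.bWord_toList hn] at this
  have h' := h.eq_of_bWord_eq (s := ∅) (p := p) hn (by rw [this, wordB_empty])
  rw [h', ← Finset.bot_eq_empty, symmDiff_bot]

theorem IsExtremal.wordB_univ (h : IsExtremal ψ M) (hn : 3 ≤ n) (k : Fin n) :
    wordB ψ M Finset.univ = M (.B k) (M (.A k) ψ) := by
  have := h.A_wordB_of_notMem hn (Finset.notMem_empty k)
  rw [wordB_empty] at this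
  rw [this, h.B_wordB hn]
  congr 1
  ext x
  simp only [Finset.mem_univ, Finset.mem_symmDiff, Finset.mem_singleton, Finset.mem_compl,
    Finset.mem_insert, Finset.notMem_empty]
  grind

theorem IsExtremal.N_state (h : IsExtremal ψ M) (hn : 3 ≤ n) {i j : Fin n} (hij : i ≠ j) :
    M (.N (edge hij)) ψ = -wordB ψ M Finset.univ := by
  obtain ⟨k, hik, hjk⟩ := exists_ne_ne hn i j
  rw [h.N_eq_neg_B_A hij hik hjk, h.wordB_univ hn k]

/-- No context contains both A_i and B_i, so B_s ψ is first rewritten as A_j B_q ψ with i ∉ q and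
the A-A-N words are used. -/
theorem IsExtremal.A_wordB_of_mem (h : IsExtremal ψ M) (hn : 3 ≤ n) {i : Fin n}
    {s : Finset (Fin n)} (hi : i ∈ s) :
    M (.A i) (wordB ψ M s) = -wordB ψ M (insert i sᶜ) := by
  -- for `i ≠ j` and `i ∉ p`, `A_i A_j B_q ψ = B_p N_ij ψ`
  have key : ∀ j, ∀ p q : Finset (Fin n), (hij : i ≠ j) → Disjoint p q →
      (∀ x, x ∈ p ∨ x ∈ q ↔ x ≠ i ∧ x ≠ j) →
      M (.A i) (M (.A j) (wordB ψ M q)) = -wordB ψ M pᶜ := by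
    intro j p q hij hd hu
    have := h.N_word hij hd hu
      (w := .N (edge hij) :: (p.toList.map Obs.B ++ (.A i :: .A j :: q.toList.map Obs.B)))
      (List.perm_iff_count.2 fun a => by
        simp only [List.count_append, List.count_cons]; omega)
    simp only [List.map_append, List.map_cons, List.prod_append, List.prod_cons,
      prod_map_map_B, mul_apply_eq_comp, h.bWord_toList hn] at this
    have h' := congrArg (M (.N (edge hij))) this
    rw [h.apply_apply, h.N_state hn hij] at h'
    rw [h.eq_neg_of_bWord_eq hn h']
    congr 2
    ext x
    simp [Finset.mem_symmDiff]
  by_cases hs : s = Finset.univ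
  -- No j lies outside the full set, so A_i B_i ψ = -B_univ ψ is obtained first and then inverted by
  -- A_i.
  · subst hs
    obtain ⟨j, hij, -⟩ := exists_ne_ne hn i i
    have h1 := key j ∅ {i, j}ᶜ hij (by simp) (by simp)
    rw [h.A_wordB_of_notMem hn (by simp)] at h1
    have h2 := congrArg (M (.A i)) h1
    rw [h.apply_apply, map_neg, Finset.compl_empty] at h2
    rw [eq_neg_iff_add_eq_zero, add_comm, ← eq_neg_iff_add_eq_zero, ← h2]
    congr 1
    ext x
    simp
    grind
  · obtain ⟨j, hj⟩ : ∃ j, j ∉ s := by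
      by_contra! hc
      exact hs (Finset.eq_univ_iff_forall.2 hc)
    have hij : i ≠ j := fun hc => hj (hc ▸ hi)
    have h1 := key j (s.erase i) (insert j s)ᶜ hij
      (Finset.disjoint_left.2 fun x hx => by
        have := Finset.mem_of_mem_erase hx
        simp [this])
      (fun x => by
        simp only [Finset.mem_erase, Finset.mem_compl, Finset.mem_insert]
        grind)
    rw [h.A_wordB_of_notMem hn (by simp)] at h1
    rw [show (insert i sᶜ : Finset (Fin n)) = (s.erase i)ᶜ by ext x; simp, ← h1]
    congr 2
    ext x
    simp
    grind

/-- How `N_ij` acts on the spanning vectors. -/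
theorem IsExtremal.N_wordB_of_notMem_notMem (h : IsExtremal ψ M) (hn : 3 ≤ n) {i j : Fin n}
    (hij : i ≠ j) {s : Finset (Fin n)} (hi : i ∉ s) (hj : j ∉ s) :
    M (.N (edge hij)) (wordB ψ M s) = -wordB ψ M sᶜ := by
  set p : Finset (Fin n) := (insert i (insert j s))ᶜ with hp
  have := h.N_word hij (p := p) (q := s)
    (Finset.disjoint_left.2 fun x hx => by simp [hp] at hx; exact hx.2.2)
    (fun x => by simp only [hp, Finset.mem_compl, Finset.mem_insert]; grind)
    (w := .A j :: .A i :: (p.toList.map Obs.B ++ (.N (edge hij) :: s.toList.map Obs.B)))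
    (List.perm_iff_count.2 fun a => by
      simp only [List.count_append, List.count_cons]; omega)
  simp only [List.map_append, List.map_cons, List.prod_append, List.prod_cons,
    prod_map_map_B, mul_apply_eq_comp, h.bWord_toList hn] at this
  have h' := congrArg (M (.A i)) (congrArg (M (.A j)) this)
  rw [h.apply_apply, h.apply_apply] at h'
  have hA := h.A_wordB_of_notMem hn (Finset.notMem_empty j)
  rw [wordB_empty] at hA
  rw [hA, h.A_wordB_of_mem hn (by simp [hij])] at h'
  rw [h.eq_neg_of_bWord_eq hn h']
  congr 2
  ext x
  simp [Finset.mem_symmDiff, hp]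
  grind

/-- As in the other two cases, A_i and A_j are distributed around N_ij so that what stands to its
right is ±B_s ψ; here A_j B_q ψ = B_s ψ. -/
theorem IsExtremal.N_wordB_of_mem_notMem (h : IsExtremal ψ M) (hn : 3 ≤ n) {i j : Fin n}
    (hij : i ≠ j) {s : Finset (Fin n)} (hi : i ∈ s) (hj : j ∉ s) :
    M (.N (edge hij)) (wordB ψ M s) = wordB ψ M sᶜ := by
  set q : Finset (Fin n) := (insert j s)ᶜ with hq
  have := h.N_word hij (p := s.erase i) (q := q)
    (Finset.disjoint_left.2 fun x hx => by simp [Finset.mem_of_mem_erase hx, hq])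
    (fun x => by simp only [hq, Finset.mem_compl, Finset.mem_insert, Finset.mem_erase]; grind)
    (w := .A i :: ((s.erase i).toList.map Obs.B ++
      (.N (edge hij) :: .A j :: q.toList.map Obs.B)))
    (List.perm_iff_count.2 fun a => by
      simp only [List.count_append, List.count_cons]; omega)
  simp only [List.map_append, List.map_cons, List.prod_append, List.prod_cons,
    prod_map_map_B, mul_apply_eq_comp, h.bWord_toList hn] at this
  have h' := congrArg (M (.A i)) this
  have hA := h.A_wordB_of_notMem hn (Finset.notMem_empty i)
  rw [wordB_empty] at hA
  rw [h.apply_apply, hA, h.A_wordB_of_notMem hn (by simp [hq])] at h'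
  have hs : (insert j q)ᶜ = s := by ext x; simp [hq]; grind
  rw [hs] at h'
  rw [h.eq_of_bWord_eq hn h']
  congr 1
  ext x
  simp [Finset.mem_symmDiff]
  grind

theorem IsExtremal.N_wordB_of_mem_mem (h : IsExtremal ψ M) (hn : 3 ≤ n) {i j : Fin n}
    (hij : i ≠ j) {s : Finset (Fin n)} (hi : i ∈ s) (hj : j ∈ s) :
    M (.N (edge hij)) (wordB ψ M s) = -wordB ψ M sᶜ := by
  set r : Finset (Fin n) := (s.erase i).erase j with hr
  have := h.N_word hij (p := sᶜ) (q := r)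
    (Finset.disjoint_left.2 fun x hx => by
      rw [Finset.mem_compl] at hx; simp [hr, hx])
    (fun x => by simp only [hr, Finset.mem_compl, Finset.mem_erase]; grind)
    (w := (sᶜ).toList.map Obs.B ++ (.N (edge hij) :: .A i :: .A j :: r.toList.map Obs.B))
    (List.perm_iff_count.2 fun a => by
      simp only [List.count_append, List.count_cons]; omega)
  simp only [List.map_append, List.map_cons, List.prod_append, List.prod_cons,
    prod_map_map_B, mul_apply_eq_comp, h.bWord_toList hn] at this
  rw [h.A_wordB_of_notMem hn (by simp [hr]), h.A_wordB_of_mem hn (by simp [hr, hij]),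
    compl_compl] at this
  have hs : insert i (insert j r) = s := by ext x; simp [hr]; grind
  rw [hs, map_neg, ← wordB_empty (ψ := ψ) (M := M)] at this
  have h' := h.eq_of_bWord_eq hn this
  rw [wordB_empty] at h'
  rw [← neg_eq_iff_eq_neg, h', ← Finset.bot_eq_empty, symmDiff_bot]

end Action

/-! ### Orthonormal basis and the unitary onto the qubits -/

section SelfTest

variable {n : ℕ}

/-- The observable `a` maps the spanning vector of `s` to a multiple of that of
`actionSet a s`. -/
def actionSet : Obs n → Finset (Fin n) → Finset (Fin n)
  | .A i, s => if i ∈ s then insert i sᶜ else (insert i s)ᶜ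
  | .B i, s => symmDiff {i} s
  | .N _, s => sᶜ

open scoped Classical in
/-- The sign with which `a` maps the spanning vector of `s` to that of `actionSet a s`. -/
noncomputable def actionSign : Obs n → Finset (Fin n) → ℂ
  | .A i, s => if i ∈ s then -1 else 1
  | .B _, _ => 1
  | .N e, s => if (∃ k ∈ e.1, k ∈ s) ∧ ∃ k ∈ e.1, k ∉ s then 1 else -1

variable {H : Type*} [NormedAddCommGroup H] [InnerProductSpace ℂ H] [CompleteSpace H]
  {ψ : H} {M : Obs n → H →L[ℂ] H}

/-- Sign and target set involve neither ψ nor M, so any two extremal realizations share this table.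
-/
theorem IsExtremal.apply_wordB (h : IsExtremal ψ M) (hn : 3 ≤ n) (a : Obs n)
    (s : Finset (Fin n)) :
    M a (wordB ψ M s) = actionSign a s • wordB ψ M (actionSet a s) := by
  cases a with
  | A i =>
    by_cases hi : i ∈ s
    · simp [actionSign, actionSet, hi, h.A_wordB_of_mem hn hi]
    · simp [actionSign, actionSet, hi, h.A_wordB_of_notMem hn hi]
  | B i => simp [actionSign, actionSet, h.B_wordB hn]
  | N e =>
    obtain ⟨i, j, hij, rfl⟩ := exists_eq_edge e
    by_cases hi : i ∈ s <;> by_cases hj : j ∈ s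
    · simp [actionSign, actionSet, hi, hj, h.N_wordB_of_mem_mem hn hij hi hj]
    · simp [actionSign, actionSet, hi, hj, h.N_wordB_of_mem_notMem hn hij hi hj]
    · rw [edge_comm]
      simp [actionSign, actionSet, hi, hj, h.N_wordB_of_mem_notMem hn hij.symm hj hi]
    · simp [actionSign, actionSet, hi, hj, h.N_wordB_of_notMem_notMem hn hij hi hj]

theorem IsRealization.inner_bWord (h : IsRealization ψ M) (l : List (Fin n)) (v w : H) :
    inner ℂ (bWord M l v) (bWord M l w) = inner ℂ v w := by
  induction l with
  | nil => simp
  | cons i l ih => rw [bWord_cons, bWord_cons, h.inner_apply, h.apply_apply, ih]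

/-- For i ∈ u, the inner-product-preserving operator A_i ∏_{k ≠ i} B_k fixes ψ and negates B_u ψ, so
the inner product equals its own negative. -/
theorem IsExtremal.inner_state_wordB (h : IsExtremal ψ M) (hn : 3 ≤ n) {u : Finset (Fin n)}
    (hu : u.Nonempty) : inner ℂ ψ (wordB ψ M u) = 0 := by
  obtain ⟨i, hi⟩ := hu
  have h0 : M (.A i) (wordB ψ M {i}ᶜ) = ψ := by
    rw [h.A_wordB_of_notMem hn (by simp),
      show (insert i ({i}ᶜ : Finset (Fin n)))ᶜ = ∅ by ext x; simp, wordB_empty]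
  have h1 : M (.A i) (bWord M ({i}ᶜ : Finset (Fin n)).toList (wordB ψ M u)) = -wordB ψ M u := by
    rw [h.bWord_wordB hn, h.A_wordB_of_mem hn (by simp [Finset.mem_symmDiff, hi])]
    congr 2
    ext x
    simp only [Finset.mem_insert, Finset.mem_compl, Finset.mem_symmDiff, Finset.mem_singleton]
    grind
  have h2 : inner ℂ ψ (wordB ψ M u) = inner ℂ ψ (-wordB ψ M u) :=
    calc inner ℂ ψ (wordB ψ M u)
        = inner ℂ (wordB ψ M {i}ᶜ) (bWord M ({i}ᶜ : Finset (Fin n)).toList (wordB ψ M u)) := by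
          rw [← h.bWord_toList hn {i}ᶜ, h.inner_bWord]
      _ = inner ℂ (M (.A i) (wordB ψ M {i}ᶜ)) (-wordB ψ M u) := by
          rw [← h1, h.inner_apply, h.apply_apply]
      _ = inner ℂ ψ (-wordB ψ M u) := by rw [h0]
  rw [inner_neg_right] at h2
  exact self_eq_neg.1 h2

theorem IsExtremal.orthonormal_wordB (h : IsExtremal ψ M) (hn : 3 ≤ n) :
    Orthonormal ℂ (wordB ψ M) := by
  rw [orthonormal_iff_ite]
  intro s t
  -- Writing B_t ψ = B_s B_{s Δ t} ψ and removing B_s from both sides reduces to pairing ψ with B_{s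
  -- Δ t} ψ.
  have ht := h.bWord_wordB hn s (symmDiff s t)
  rw [symmDiff_symmDiff_cancel_left] at ht
  rw [← h.bWord_toList hn s, ← ht, h.inner_bWord]
  split_ifs with hst
  · rw [hst, symmDiff_self, Finset.bot_eq_empty, wordB_empty, inner_self_eq_norm_sq_to_K,
      h.norm_state]
    simp
  · refine h.inner_state_wordB hn (Finset.nonempty_iff_ne_empty.2 fun hc => hst ?_)
    rwa [← Finset.bot_eq_empty, symmDiff_eq_bot] at hc

theorem IsExtremal.apply_mem_invSubspace (h : IsExtremal ψ M) (hn : 3 ≤ n) (a : Obs n) {v : H}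
    (hv : v ∈ invSubspace ψ M) : M a v ∈ invSubspace ψ M := by
  induction hv using Submodule.span_induction with
  | mem x hx =>
    obtain ⟨s, rfl⟩ := hx
    rw [h.apply_wordB hn]
    exact Submodule.smul_mem _ _ (wordB_mem_invSubspace _)
  | zero => simp
  | add x y _ _ hx hy => rw [map_add]; exact Submodule.add_mem _ hx hy
  | smul c x _ hx => rw [map_smul]; exact Submodule.smul_mem _ c hx

/-- The orthonormal basis of `V_n` formed by the vectors `B_{i₁} ⋯ B_{iₖ} ψ`. -/
noncomputable def IsExtremal.basis (h : IsExtremal ψ M) (hn : 3 ≤ n) :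
    OrthonormalBasis (Finset (Fin n)) ℂ (invSubspace ψ M) :=
  OrthonormalBasis.mk (v := fun s => (⟨wordB ψ M s, wordB_mem_invSubspace s⟩ : invSubspace ψ M))
    (by
      have := h.orthonormal_wordB hn
      rw [orthonormal_iff_ite] at this ⊢
      exact this)
    (by
      rintro ⟨v, hv⟩ -
      rw [← Submodule.apply_mem_span_image_iff_mem_span
        (f := (invSubspace ψ M).subtype) Subtype.val_injective, ← Set.range_comp]
      exact hv)

theorem IsExtremal.coe_basis (h : IsExtremal ψ M) (hn : 3 ≤ n) (s : Finset (Fin n)) :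
    (h.basis hn s : H) = wordB ψ M s := by
  simp [IsExtremal.basis]

theorem IsExtremal.finrank_invSubspace (h : IsExtremal ψ M) (hn : 3 ≤ n) :
    Module.finrank ℂ (invSubspace ψ M) = 2 ^ n := by
  rw [Module.finrank_eq_card_basis (h.basis hn).toBasis]
  simp

theorem IsExtremal.two_pow_le_rank (h : IsExtremal ψ M) (hn : 3 ≤ n) :
    (2 ^ n : Cardinal) ≤ Module.rank ℂ H := by
  refine le_trans (le_of_eq ?_) (Submodule.rank_le (invSubspace ψ M))
  rw [← Module.finrank_eq_rank, h.finrank_invSubspace hn]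
  simp

/-- The reference vectors `Z_{i₁} ⋯ Z_{iₖ} |G_n⟩` as an orthonormal basis. -/
noncomputable def pauliBasis (h : IsExtremal (completeGraphState n) (pauliObs (n := n)))
    (hn : 3 ≤ n) : OrthonormalBasis (Finset (Fin n)) ℂ (Qubits n) :=
  OrthonormalBasis.mk (h.orthonormal_wordB hn) (by
    change ⊤ ≤ invSubspace (completeGraphState n) pauliObs
    rw [Submodule.eq_top_of_finrank_eq
      (h.finrank_invSubspace hn |>.trans (by simp [finrank_euclideanSpace]))])

/-- U sends B_s ψ to Z_s |G_n⟩. Both bases obey the same action table, so intertwining is checked on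
basis vectors, and s = ∅ gives the states. -/
theorem IsExtremal.exists_unitary (h : IsExtremal ψ M)
    (h' : IsExtremal (completeGraphState n) (pauliObs (n := n))) (hn : 3 ≤ n) :
    ∃ U : invSubspace ψ M ≃ₗᵢ[ℂ] Qubits n,
      (∀ a, ∀ φ : Qubits n,
        U ((invSubspace ψ M).orthogonalProjectionOnto
          (M a ((invSubspace ψ M).subtypeL (U.symm φ)))) = pauliObs a φ) ∧
      U ((invSubspace ψ M).orthogonalProjectionOnto ψ) = completeGraphState n := by
  set b := h.basis hn with hb
  set b' := pauliBasis h' hn with hb'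
  have hb's : ∀ s, b' s = wordB (completeGraphState n) pauliObs s := fun s => by
    simp [hb', pauliBasis]
  have hproj : ∀ s, (invSubspace ψ M).orthogonalProjectionOnto (wordB ψ M s) = b s := fun s => by
    rw [← h.coe_basis hn]
    exact Submodule.orthogonalProjectionOnto_mem_subspace_eq_self _
  set U := b.equiv b' (Equiv.refl _) with hU
  have hUb : ∀ s, U (b s) = b' s := fun s => by simp [hU]
  have hUs : ∀ s, U.symm (b' s) = b s := fun s => by rw [← hUb, U.symm_apply_apply]
  refine ⟨U, fun a φ => ?_, ?_⟩
  · have : (U.toLinearEquiv.toLinearMap ∘ₗ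
        (invSubspace ψ M).orthogonalProjectionOnto.toLinearMap ∘ₗ (M a).toLinearMap ∘ₗ
          (invSubspace ψ M).subtype ∘ₗ U.symm.toLinearEquiv.toLinearMap) =
        (pauliObs a).toLinearMap := by
      refine b'.toBasis.ext fun s => ?_
      rw [OrthonormalBasis.coe_toBasis]
      change U ((invSubspace ψ M).orthogonalProjectionOnto (M a (U.symm (b' s) : H))) =
        pauliObs a (b' s)
      rw [hUs, hb, h.coe_basis, h.apply_wordB hn, map_smul, hproj, map_smul, hUb, hb's, hb's,
        h'.apply_wordB hn]
    exact LinearMap.congr_fun this φ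
  · have := hproj ∅
    rw [wordB_empty] at this
    rw [this, hUb, hb's, wordB_empty]

end SelfTest

end TemporalSelfTest

theorem theorem2 (n : ℕ) (hn : 3 ≤ n) (π : ∀ c : Finset (Obs n), PermScheme c) :
    -- the classical bound, the quantum bound, and the gap between them
    IsGreatest (Set.range (classicalValue n)) (etaC n) ∧
    etaC n < etaQ n ∧
    (∀ (H : Type*) [NormedAddCommGroup H] [InnerProductSpace ℂ H] [CompleteSpace H]
      (ψ : H) (M : Obs n → H →L[ℂ] H), IsRealization ψ M → temporalValue π ψ M ≤ etaQ n) ∧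
    -- the complete-graph state and its characterization by stabilizers
    IsGraphState ⊤ (completeGraphState n) ∧
    (∀ φ : Qubits n, IsGraphState ⊤ φ → ∃ z : ℂ, ‖z‖ = 1 ∧ φ = z • completeGraphState n) ∧
    -- the reference experiment is a realization and attains the quantum bound
    IsRealization (completeGraphState n) (pauliObs (n := n)) ∧
    temporalValue π (completeGraphState n) (pauliObs (n := n)) = etaQ n ∧
    -- self-testing
    (∀ (H : Type*) [NormedAddCommGroup H] [InnerProductSpace ℂ H] [CompleteSpace H]
      (ψ : H) (M : Obs n → H →L[ℂ] H), IsRealization ψ M → temporalValue π ψ M = etaQ n →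
      (∀ a, ∀ v ∈ invSubspace ψ M, M a v ∈ invSubspace ψ M) ∧
      Module.finrank ℂ (invSubspace ψ M) = 2 ^ n ∧
      (2 ^ n : Cardinal) ≤ Module.rank ℂ H ∧
      ∃ U : invSubspace ψ M ≃ₗᵢ[ℂ] Qubits n,
        (∀ a, ∀ φ : Qubits n,
          U ((invSubspace ψ M).orthogonalProjectionOnto (M a ((invSubspace ψ M).subtypeL (U.symm φ)))) =
            pauliObs a φ) ∧
        U ((invSubspace ψ M).orthogonalProjectionOnto ψ) = completeGraphState n ∧
        ψ ∈ invSubspace ψ M) := by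
  have href := isRealization_pauliObs (n := n)
  refine ⟨isGreatest_classicalValue hn, etaC_lt_etaQ hn, ?_, isGraphState_completeGraphState,
    fun φ hφ => exists_phase_of_isGraphState hφ, href, temporalValue_pauliObs π, ?_⟩
  · intro H _ _ _ ψ M h
    exact expr_le_etaQ hn fun c => h.abs_piCorr_le (π c)
  · intro H _ _ _ ψ M h hT
    have hE := h.isExtremal hn π hT
    -- The reference experiment attains the bound, hence is itself extremal and supplies the target
    -- basis.
    obtain ⟨U, hU, hUψ⟩ :=
      hE.exists_unitary (href.isExtremal hn π (temporalValue_pauliObs π)) hn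
    refine ⟨fun a v hv => hE.apply_mem_invSubspace hn a hv, hE.finrank_invSubspace hn,
      hE.two_pow_le_rank hn, U, hU, hUψ, ?_⟩
    have := wordB_mem_invSubspace (ψ := ψ) (M := M) ∅
    rwa [wordB_empty] at this
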